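/- **Theorem (multilayer rate-distortion bound).** Let $K\ge 1$, $\sigma^2,\epsilon\ge 0$, and let $\mathcal{E}_{K:1}=(\mathcal{E}_1,\dots,\mathcal{E}_K)$ be a multilayer environment: $\mathcal{E}_k$ identifies a random function $f_k:\mathbb{R}^{N_{k-1}}\to\mathbb{R}^{N_k}$, $U_0=X$, $U_k=f_k(U_{k-1})$ and $Y=U_K+W$, where $W\sim\mathcal{N}(0,\sigma^2 I)$ and $\mathcal{E}_1,\dots,\mathcal{E}_K,X,W$ are independent. All random elements take values in standard Borel spaces. *Definitions.* A proxy of an environment $\mathcal{E}$ with input $X$ and output $Y$ is a random variable $\tilde{\mathcal{E}}$ (on any probability space that carries a copy of $(\mathcal{E},X,Y)$) with $\tilde{\mathcal{E}}\perp(X,Y)\mid\mathcal{E}$. For a distortion function $D$, with values in $[0,\infty]$, the rate-distortion function is $$\mathbb{H}_\epsilon(\mathcal{E},D)=\inf\{\mathbb{I}(\mathcal{E};\tilde{\mathcal{E}}) : \tilde{\mathcal{E}}\text{ a proxy of }\mathcal{E},\ D(\tilde{\mathcal{E}})\le\epsilon\}\in[0,\infty],$$ and $\mathbb{H}_\epsilon(\mathcal{E})$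 is the one for $D(\tilde{\mathcal{E}})=\mathbb{E}\big[D_{\mathrm{KL}}\big(\mathbb{P}(Y\in\cdot\mid\mathcal{E},X)\,\|\,\mathbb{P}(Y\in\cdot\mid\tilde{\mathcal{E}},X)\big)\big]$. The environment $\mathcal{E}_{K:1}$ has input $X$ and output $Y$; the single-layer environment $\mathcal{E}_k$ has input $U_{k-1}$ and output distributed as $\mathcal{N}(f_k(U_{k-1}),\sigma^2 I)$ given $\mathcal{E}_k$ and $U_{k-1}$. A multilayer proxy is a tuple $(\tilde{\mathcal{E}}_1,\dots,\tilde{\mathcal{E}}_K)$ such that, for every $k$, given $\mathcal{E}_k$ the variable $\tilde{\mathcal{E}}_k$ is independent of $\big((\mathcal{E}_j)_{j\ne k},(\tilde{\mathcal{E}}_j)_{j\ne k},X,Y\big)$. *Statement.* For each $k$ let $\Delta(\mathcal{E}_k,\tilde{\mathcal{E}}_k,U_{k-1})\in[0,\infty]$ be a quantity determined by the joint law of $(\mathcal{E}_k,\tilde{\mathcal{E}}_k,U_{k-1})$ (the functional may depend on $k$). Suppose that for every multilayer proxy and every $k\in\{1,\dots,K\}$ $$\mathbb{I}\big(Y;\mathcal{E}_k\mid\mathcal{E}_{K:k+1},\tilde{\mathcal{E}}_{k:1},X\big)\le\Delta(\mathcal{E}_k,\tilde{\mathcal{E}}_k,U_{k-1}),$$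 and that for every $k$ and every $\delta>0$ the environment $\mathcal{E}_k$ has a proxy $\tilde{\mathcal{E}}_k$ with $\Delta(\mathcal{E}_k,\tilde{\mathcal{E}}_k,U_{k-1})\le\delta$. Then $$\mathbb{H}_\epsilon(\mathcal{E}_{K:1})\le\sum_{k=1}^K\mathbb{H}_{\epsilon/K}(\mathcal{E}_k,\Delta).$$ -/

import Mathlib

open MeasureTheory ProbabilityTheory InformationTheory
open scoped ENNReal NNReal

universe u

noncomputable section

/-! ### Mutual information -/

section Information

variable {Ω : Type*} [MeasurableSpace Ω]
  {α : Type*} [MeasurableSpace α] {β : Type*} [MeasurableSpace β] {γ : Type*} [MeasurableSpace γ]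

/-- Mutual information `I(A; B)` (in nats): the Kullback-Leibler divergence of the joint law of
`(A, B)` from the product of the marginal laws. -/
def mutualInfo (A : Ω → α) (B : Ω → β) (P : Measure Ω) : ℝ≥0∞ :=
  klDiv (P.map fun ω => (A ω, B ω)) ((P.map A).prod (P.map B))

/-- Conditional mutual information `I(A; B | C)` (in nats): the Kullback-Leibler divergence of the
joint law of `(C, (A, B))` from the law under which `C` has its original law and, given `C`, the
variables `A` and `B` are independent with their original conditional laws. -/
def condMutualInfo [StandardBorelSpace α] [Nonempty α] [StandardBorelSpace β] [Nonempty β]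
    (A : Ω → α) (B : Ω → β) (C : Ω → γ) (P : Measure Ω) [IsFiniteMeasure P] : ℝ≥0∞ :=
  klDiv (P.map fun ω => (C ω, (A ω, B ω)))
    ((P.map C) ⊗ₘ (condDistrib A C P ×ₖ condDistrib B C P))

end Information

/-! ### Environments, proxies and rate-distortion functions -/

/-- A random environment with a representative input: the environment is identified by a random
parameter in `Θ` with law `prior`; the input has law `input` and is independent of the
environment; `channel (θ, x)` is the law of the output when the environment is `θ` and the
input is `x`. -/
structure Environment (Θ : Type u) (𝒳 𝒴 : Type)
    [MeasurableSpace Θ] [MeasurableSpace 𝒳] [MeasurableSpace 𝒴] where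
  prior : Measure Θ
  input : Measure 𝒳
  channel : Kernel (Θ × 𝒳) 𝒴
  isProbabilityMeasure_prior : IsProbabilityMeasure prior
  isProbabilityMeasure_input : IsProbabilityMeasure input
  isMarkovKernel_channel : IsMarkovKernel channel

namespace Environment

attribute [instance] isProbabilityMeasure_prior isProbabilityMeasure_input isMarkovKernel_channel

variable {Θ : Type u} {𝒳 𝒴 : Type} [MeasurableSpace Θ] [MeasurableSpace 𝒳] [MeasurableSpace 𝒴]

/-- The joint law of environment, input and output. -/
def jointLaw (𝓔 : Environment Θ 𝒳 𝒴) : Measure ((Θ × 𝒳) × 𝒴) :=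
  (𝓔.prior.prod 𝓔.input) ⊗ₘ 𝓔.channel

/-- An environment proxy: a random variable `proxy`, defined together with the environment
`env`, the input `X` and the output `Y` on some probability space, which is conditionally
independent of `(X, Y)` given the environment. -/
structure Proxy (𝓔 : Environment Θ 𝒳 𝒴) where
  {Ω : Type u}
  [measurableSpaceΩ : MeasurableSpace Ω]
  [standardBorelΩ : StandardBorelSpace Ω]
  P : Measure Ω
  [isProbabilityMeasure : IsProbabilityMeasure P]
  {Z : Type u}
  [measurableSpaceZ : MeasurableSpace Z]
  [standardBorelZ : StandardBorelSpace Z]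
  env : Ω → Θ
  X : Ω → 𝒳
  Y : Ω → 𝒴
  proxy : Ω → Z
  measurable_env : Measurable env
  measurable_X : Measurable X
  measurable_Y : Measurable Y
  measurable_proxy : Measurable proxy
  map_eq : P.map (fun ω => ((env ω, X ω), Y ω)) = 𝓔.jointLaw
  condIndep : proxy ⟂ᵢ[env, measurable_env; P] (fun ω => (X ω, Y ω))

attribute [instance] Proxy.measurableSpaceΩ Proxy.standardBorelΩ Proxy.isProbabilityMeasure
  Proxy.measurableSpaceZ Proxy.standardBorelZ

/-- The rate of a proxy: its mutual information with the environment. -/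
def Proxy.rate {𝓔 : Environment Θ 𝒳 𝒴} (p : 𝓔.Proxy) : ℝ≥0∞ :=
  mutualInfo p.env p.proxy p.P

/-- The expected error `𝔼[D_KL(P* ‖ P̃)]` of prediction from the proxy, where
`P* = ℙ(Y ∈ · | env, X)` is the target distribution and `P̃ = ℙ(Y ∈ · | proxy, X)`. -/
def Proxy.klError [StandardBorelSpace 𝒴] [Nonempty 𝒴] {𝓔 : Environment Θ 𝒳 𝒴}
    (p : 𝓔.Proxy) : ℝ≥0∞ :=
  ∫⁻ ω, klDiv (𝓔.channel (p.env ω, p.X ω))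
    (condDistrib p.Y (fun ω' => (p.proxy ω', p.X ω')) p.P (p.proxy ω, p.X ω)) ∂p.P

/-- The rate-distortion function with respect to a distortion function `D`: the infimum of the
rates of the proxies of distortion at most `ε` (it is `∞` if there are none). -/
def rateDistortionWith (𝓔 : Environment Θ 𝒳 𝒴) (D : 𝓔.Proxy → ℝ≥0∞) (ε : ℝ≥0) : ℝ≥0∞ :=
  ⨅ (p : 𝓔.Proxy) (_ : D p ≤ ε), p.rate

/-- The rate-distortion function `ℍ_ε(𝓔)`, with respect to the expected error. -/
def rateDistortion [StandardBorelSpace 𝒴] [Nonempty 𝒴] (𝓔 : Environment Θ 𝒳 𝒴) (ε : ℝ≥0) :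
    ℝ≥0∞ :=
  𝓔.rateDistortionWith (fun p => p.klError) ε

end Environment

/-- A distortion function `Δ(𝓔, 𝓔̃, U)` of an environment in `Θ`, a proxy and an input in `𝒳`:
an extended nonnegative number that is determined by the joint law of the three. -/
abbrev DistortionFunction (Θ : Type u) (𝒳 : Type) [MeasurableSpace Θ] [MeasurableSpace 𝒳] :=
  ∀ (Z : Type u) [MeasurableSpace Z], Measure (Θ × Z × 𝒳) → ℝ≥0∞

/-- The value of a distortion function on a proxy of an environment. -/
def Environment.Proxy.distortion {Θ : Type u} {𝒳 𝒴 : Type} [MeasurableSpace Θ]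
    [MeasurableSpace 𝒳] [MeasurableSpace 𝒴] {𝓔 : Environment Θ 𝒳 𝒴} (p : 𝓔.Proxy)
    (Δ : DistortionFunction Θ 𝒳) : ℝ≥0∞ :=
  Δ p.Z (p.P.map fun ω => (p.env ω, p.proxy ω, p.X ω))

/-! ### Multilayer environments -/

/-- The law `𝓝(0, σ² I)` on `ℝⁿ`; the Dirac mass at `0` if `σ² = 0`. -/
def gaussianNoise (n : ℕ) (σ2 : ℝ≥0) : Measure (Fin n → ℝ) :=
  Measure.pi fun _ => gaussianReal 0 σ2

instance (n : ℕ) (σ2 : ℝ≥0) : IsProbabilityMeasure (gaussianNoise n σ2) := by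
  unfold gaussianNoise; infer_instance

/-- The kernel `a ↦ 𝓝(g a, σ² I)`, the law of `g a + W` with `W ∼ 𝓝(0, σ² I)`. -/
def gaussianChannel {α : Type*} [MeasurableSpace α] {n : ℕ} (g : α → Fin n → ℝ)
    (hg : Measurable g) (σ2 : ℝ≥0) : Kernel α (Fin n → ℝ) :=
  (Kernel.deterministic g hg ×ₖ Kernel.const α (gaussianNoise n σ2)).map fun p => p.1 + p.2

instance {α : Type*} [MeasurableSpace α] {n : ℕ} (g : α → Fin n → ℝ) (hg : Measurable g)
    (σ2 : ℝ≥0) : IsMarkovKernel (gaussianChannel g hg σ2) := by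
  unfold gaussianChannel; exact Kernel.IsMarkovKernel.map _ (by fun_prop)

/-- A multilayer environment with `K` layers. The layers are indexed by `Fin K`, so that layer
`k : Fin K` is the `(k+1)`-st one; its input lies in `ℝ ^ dim k.castSucc` and its output in
`ℝ ^ dim k.succ`. Layer `k` is identified by a random parameter in `Θ k` with law `prior k`; it
is the random function `layer k θ`. The parameters of the layers, the input (with law `input`)
and the noise (with law `𝓝(0, noiseVar · I)`) are mutually independent. -/
structure MultilayerEnvironment {K : ℕ} (dim : Fin (K + 1) → ℕ) (Θ : Fin K → Type u)
    [∀ k, MeasurableSpace (Θ k)] where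
  prior : ∀ k, Measure (Θ k)
  isProbabilityMeasure_prior : ∀ k, IsProbabilityMeasure (prior k)
  layer : ∀ k : Fin K, Θ k → (Fin (dim k.castSucc) → ℝ) → (Fin (dim k.succ) → ℝ)
  measurable_layer : ∀ k, Measurable (Function.uncurry (layer k))
  input : Measure (Fin (dim 0) → ℝ)
  isProbabilityMeasure_input : IsProbabilityMeasure input
  noiseVar : ℝ≥0

namespace MultilayerEnvironment

attribute [instance] isProbabilityMeasure_prior isProbabilityMeasure_input

variable {K : ℕ} {dim : Fin (K + 1) → ℕ} {Θ : Fin K → Type u} [∀ k, MeasurableSpace (Θ k)]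

/-- `M.U j θ x` is the output of the first `j` layers on the input `x`: `U₀ = x`,
`U_{k+1} = f_k(U_k)`. -/
def U (M : MultilayerEnvironment dim Θ) (j : Fin (K + 1)) (θ : ∀ k, Θ k)
    (x : Fin (dim 0) → ℝ) : Fin (dim j) → ℝ :=
  Fin.induction (motive := fun j => Fin (dim j) → ℝ) x (fun k u => M.layer k (θ k) u) j

theorem measurable_U (M : MultilayerEnvironment dim Θ) (j : Fin (K + 1)) :
    Measurable fun p : (∀ k, Θ k) × (Fin (dim 0) → ℝ) => M.U j p.1 p.2 := by
  induction j using Fin.induction with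
  | zero => exact measurable_snd
  | succ k ih =>
    have h : (fun p : (∀ k, Θ k) × (Fin (dim 0) → ℝ) => M.U k.succ p.1 p.2) =
        fun p => Function.uncurry (M.layer k) (p.1 k, M.U k.castSucc p.1 p.2) := by
      funext p; simp [U, Function.uncurry]
    rw [h]
    exact (M.measurable_layer k).comp
      (((measurable_pi_apply k).comp measurable_fst).prodMk ih)

/-- The whole environment `𝓔_{K:1}`, from the input `X` to the output `Y = U_K + W`. -/
def toEnvironment (M : MultilayerEnvironment dim Θ) :
    Environment (∀ k, Θ k) (Fin (dim 0) → ℝ) (Fin (dim (Fin.last K)) → ℝ) where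
  prior := Measure.pi M.prior
  input := M.input
  channel := gaussianChannel (fun p => M.U (Fin.last K) p.1 p.2) (M.measurable_U _) M.noiseVar
  isProbabilityMeasure_prior := inferInstance
  isProbabilityMeasure_input := inferInstance
  isMarkovKernel_channel := inferInstance

/-- The law of the true input of layer `k`. -/
def layerInput (M : MultilayerEnvironment dim Θ) (k : Fin K) :
    Measure (Fin (dim k.castSucc) → ℝ) :=
  ((Measure.pi M.prior).prod M.input).map fun p => M.U k.castSucc p.1 p.2

/-- The single-layer environment `𝓔_k`: its input is the true input of layer `k`, its output is
`𝓝(f_k(u), σ² I)`-distributed when its input is `u`. -/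
def layerEnvironment (M : MultilayerEnvironment dim Θ) (k : Fin K) :
    Environment (Θ k) (Fin (dim k.castSucc) → ℝ) (Fin (dim k.succ) → ℝ) where
  prior := M.prior k
  input := M.layerInput k
  channel := gaussianChannel (Function.uncurry (M.layer k)) (M.measurable_layer k) M.noiseVar
  isProbabilityMeasure_prior := inferInstance
  isProbabilityMeasure_input :=
    Measure.isProbabilityMeasure_map (M.measurable_U _).aemeasurable
  isMarkovKernel_channel := inferInstance

/-- A multilayer proxy: a tuple `proxy` of random variables, defined together with the layers
`env k`, the input `X` and the output `Y` on some probability space, such that given layer `k`,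
the `k`-th proxy is independent of the other layers, the other proxies, the input and the
output. -/
structure MultilayerProxy (M : MultilayerEnvironment dim Θ) where
  {Ω : Type u}
  [measurableSpaceΩ : MeasurableSpace Ω]
  [standardBorelΩ : StandardBorelSpace Ω]
  P : Measure Ω
  [isProbabilityMeasure : IsProbabilityMeasure P]
  {Z : Fin K → Type u}
  [measurableSpaceZ : ∀ k, MeasurableSpace (Z k)]
  [standardBorelZ : ∀ k, StandardBorelSpace (Z k)]
  env : ∀ k, Ω → Θ k
  X : Ω → (Fin (dim 0) → ℝ)
  Y : Ω → (Fin (dim (Fin.last K)) → ℝ)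
  proxy : ∀ k, Ω → Z k
  measurable_env : ∀ k, Measurable (env k)
  measurable_X : Measurable X
  measurable_Y : Measurable Y
  measurable_proxy : ∀ k, Measurable (proxy k)
  map_eq : P.map (fun ω => (((fun k => env k ω), X ω), Y ω)) = M.toEnvironment.jointLaw
  condIndep : ∀ k, (proxy k) ⟂ᵢ[env k, measurable_env k; P]
    (fun ω => ((fun j : {j // j ≠ k} => env j ω), (fun j : {j // j ≠ k} => proxy j ω),
      X ω, Y ω))

attribute [instance] MultilayerProxy.measurableSpaceΩ MultilayerProxy.standardBorelΩ
  MultilayerProxy.isProbabilityMeasure MultilayerProxy.measurableSpaceZ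
  MultilayerProxy.standardBorelZ

/-- The contribution `I(Y; 𝓔_k | 𝓔_{K:k+1}, 𝓔̃_{k:1}, X)` of layer `k` to the distortion of a
multilayer proxy. -/
def MultilayerProxy.layerContribution [∀ k, StandardBorelSpace (Θ k)] [∀ k, Nonempty (Θ k)]
    {M : MultilayerEnvironment dim Θ} (p : M.MultilayerProxy) (k : Fin K) : ℝ≥0∞ :=
  condMutualInfo p.Y (p.env k)
    (fun ω => ((fun j : {j // k < j} => p.env j ω), (fun j : {j // j ≤ k} => p.proxy j ω), p.X ω))
    p.P

/-- The per-layer distortion `Δ(𝓔_k, 𝓔̃_k, U_{k-1})` of the `k`-th component of a multilayer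
proxy, where `U_{k-1}` is the true input of layer `k`. -/
def MultilayerProxy.layerDistortion {M : MultilayerEnvironment dim Θ} (p : M.MultilayerProxy)
    (k : Fin K) (Δ : DistortionFunction (Θ k) (Fin (dim k.castSucc) → ℝ)) : ℝ≥0∞ :=
  Δ (p.Z k) (p.P.map fun ω =>
    (p.env k ω, p.proxy k ω, M.U k.castSucc (fun i => p.env i ω) (p.X ω)))

end MultilayerEnvironment

end

/-! Take for each layer a proxy of distortion at most `ε / K` whose rate is nearly optimal, and
realise all layers with their proxies independently of each other, of a fresh input and of the
noise. The tuple is a proxy of the whole environment and also a multilayer proxy.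

Rate: the joint law of layers and proxies is a product over the layers, and so is the product of the
marginals. Divergence is additive over products (`klDiv_pi`), so the rate is at most the sum of the
rates (`rate_combinedProxy_le`).

Error: condition `Y` on the first `n` proxies, the remaining environments and `X`. At `n = 0` the
prediction is exact; at `n = K` it uses only the proxies and `X`. Passing from `k` to `k + 1` means
adding the proxy of layer `k`, then deleting the environment of layer `k`. The addition changes
nothing, since given its environment the proxy is independent of the rest
(`compProd_condLaw_layerContext_env`). The deletion costs exactly `I(Y; E_k | C)`, where `C` is what
remains (`klDiv_compProd_condLaw_eq_add`). Hence the expected error is at most the sum of the layer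
contributions (`lintegral_klDiv_le_sum_condMutualInfo`).

The hypothesis bounds each contribution by the distortion in the combined model. The true input of a
layer is independent of that layer and its proxy, so this is the distortion of the chosen
single-layer proxy (`layerDistortion_combinedMultilayerProxy`), at most `ε / K`. -/

/-! ### Kullback-Leibler divergence -/

namespace InformationTheory

variable {α β : Type*} [MeasurableSpace α] [MeasurableSpace β]

/-- The Kullback-Leibler divergence is invariant under maps with a measurable left inverse. -/
theorem klDiv_map_of_leftInverse (μ ν : Measure α) [IsFiniteMeasure μ] [IsFiniteMeasure ν]
    {g : α → β} {h : β → α} (hg : Measurable g) (hh : Measurable h)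
    (hgh : Function.LeftInverse h g) : klDiv (μ.map g) (ν.map g) = klDiv μ ν := by
  refine le_antisymm (klDiv_map_le μ ν hg) ?_
  have h1 := klDiv_map_le (μ.map g) (ν.map g) hh
  rwa [Measure.map_map hh hg, Measure.map_map hh hg, hgh.comp_eq_id, Measure.map_id,
    Measure.map_id] at h1

/-- The integral of the divergences of two kernels is at most the divergence of the
composition-products. -/
theorem lintegral_klDiv_le_klDiv_compProd [MeasurableSpace.CountablyGenerated β] (μ : Measure α)
    [IsFiniteMeasure μ] (κ η : Kernel α β) [IsMarkovKernel κ] [IsMarkovKernel η] :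
    ∫⁻ a, klDiv (κ a) (η a) ∂μ ≤ klDiv (μ ⊗ₘ κ) (μ ⊗ₘ η) := by
  by_cases hac : μ ⊗ₘ κ ≪ μ ⊗ₘ η
  swap; · simp [klDiv_of_not_ac hac]
  have hae := hac.kernel_of_compProd
  rw [klDiv_eq_lintegral_klFun_of_ac hac, Measure.lintegral_compProd (by fun_prop)]
  -- Jointly, the density is the fibrewise density `Kernel.rnDeriv`, so the joint `klFun` integral
  -- splits into the fibre divergences.
  have hd : μ ⊗ₘ κ = (μ ⊗ₘ η).withDensity (fun p => Kernel.rnDeriv κ η p.1 p.2) := by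
    have hm : Measurable fun p : α × β => Kernel.rnDeriv κ η p.1 p.2 :=
      Kernel.measurable_rnDeriv κ η
    ext s hs
    rw [withDensity_apply _ hs, ← lintegral_indicator hs,
      Measure.lintegral_compProd (hm.indicator hs), Measure.compProd_apply hs]
    refine lintegral_congr_ae ?_
    filter_upwards [hae] with a ha
    have hs' : MeasurableSet (Prod.mk a ⁻¹' s) := measurable_prodMk_left hs
    rw [← Kernel.setLIntegral_rnDeriv ha hs', ← lintegral_indicator hs']
    rfl
  have h1 : (fun p => (μ ⊗ₘ κ).rnDeriv (μ ⊗ₘ η) p) =ᵐ[μ ⊗ₘ η]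
      fun p => Kernel.rnDeriv κ η p.1 p.2 := by
    conv_lhs => rw [hd]
    exact Measure.rnDeriv_withDensity _ (Kernel.measurable_rnDeriv κ η)
  have h2 := Measure.ae_ae_of_ae_compProd h1
  refine lintegral_mono_ae ?_
  filter_upwards [h2, hae] with a ha1 ha2
  rw [klDiv_eq_lintegral_klFun_of_ac ha2]
  refine le_of_eq (lintegral_congr_ae ?_)
  filter_upwards [ha1, Kernel.rnDeriv_eq_rnDeriv_measure (κ := κ) (η := η) (a := a)] with y hy1 hy2
  rw [hy1, hy2]

/-- The chain rule with constant kernels leaves a term whose first factor is common; after a swap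
that factor is a common kernel and drops out. -/
theorem klDiv_prod_eq_add (μ₁ ν₁ : Measure α) (μ₂ ν₂ : Measure β) [IsProbabilityMeasure μ₁]
    [IsProbabilityMeasure ν₁] [IsProbabilityMeasure μ₂] [IsProbabilityMeasure ν₂] :
    klDiv (μ₁.prod μ₂) (ν₁.prod ν₂) = klDiv μ₁ ν₁ + klDiv μ₂ ν₂ := by
  rw [← Measure.compProd_const, ← Measure.compProd_const, klDiv_compProd_eq_add,
    Measure.compProd_const, Measure.compProd_const, ← Measure.prod_swap,
    ← Measure.prod_swap (μ := ν₂), klDiv_map_of_leftInverse _ _ measurable_swap measurable_swap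
      Prod.swap_leftInverse, ← Measure.compProd_const, ← Measure.compProd_const,
    klDiv_compProd_left]

theorem klDiv_pi {n : ℕ} {α : Fin n → Type*} [∀ i, MeasurableSpace (α i)]
    (μ ν : ∀ i, Measure (α i)) [∀ i, IsProbabilityMeasure (μ i)]
    [∀ i, IsProbabilityMeasure (ν i)] :
    klDiv (Measure.pi μ) (Measure.pi ν) = ∑ i, klDiv (μ i) (ν i) := by
  induction n with
  | zero => simp [Measure.pi_of_empty μ, Measure.pi_of_empty ν]
  | succ n ih =>
    rw [Fin.sum_univ_succ, ← ih, ← klDiv_prod_eq_add,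
      ← klDiv_map_of_leftInverse (Measure.pi μ) (Measure.pi ν)
        (MeasurableEquiv.piFinSuccAbove α 0).measurable
        (MeasurableEquiv.piFinSuccAbove α 0).symm.measurable
        (MeasurableEquiv.piFinSuccAbove α 0).left_inv,
      (measurePreserving_piFinSuccAbove μ 0).map_eq, (measurePreserving_piFinSuccAbove ν 0).map_eq]
    rfl

end InformationTheory

/-! ### Products of measures -/

namespace MeasureTheory

/-- A product of products of measures, with the factors regrouped. -/
theorem pi_prod_map_eq {ι : Type*} [Fintype ι] {α β : ι → Type*} [∀ i, MeasurableSpace (α i)]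
    [∀ i, MeasurableSpace (β i)] (μ : ∀ i, Measure (α i)) (ν : ∀ i, Measure (β i))
    [∀ i, IsProbabilityMeasure (μ i)] [∀ i, IsProbabilityMeasure (ν i)] :
    (Measure.pi fun i => (μ i).prod (ν i)).map
      (fun p => ((fun i => (p i).1), (fun i => (p i).2))) =
        (Measure.pi μ).prod (Measure.pi ν) := by
  have h : Measure.pi (fun i => (μ i).prod (ν i)) =
      ((Measure.pi μ).prod (Measure.pi ν)).map (fun p i => (p.1 i, p.2 i)) := by
    refine Measure.pi_eq_generateFrom (fun _ => generateFrom_prod) (fun _ => isPiSystem_prod)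
      (fun i => (μ i).toFiniteSpanningSetsIn.prod (ν i).toFiniteSpanningSetsIn) fun s hs => ?_
    choose t ht u hu hs using hs
    obtain rfl : s = fun i => t i ×ˢ u i := funext fun i => (hs i).symm
    have hm : MeasurableSet (Set.univ.pi fun i => t i ×ˢ u i) :=
      .univ_pi fun i => (ht i).prod (hu i)
    rw [Measure.map_apply (by fun_prop) hm]
    have he : (fun (p : (∀ i, α i) × (∀ i, β i)) i => (p.1 i, p.2 i)) ⁻¹'
        (Set.univ.pi fun i => t i ×ˢ u i) = (Set.univ.pi t) ×ˢ (Set.univ.pi u) := by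
      ext p; simp [Set.mem_pi, forall_and]
    rw [he, Measure.prod_prod, Measure.pi_pi, Measure.pi_pi, ← Finset.prod_mul_distrib]
    simp only [Measure.prod_prod]
  rw [h, Measure.map_map (by fun_prop) (by fun_prop)]
  exact Measure.map_id

end MeasureTheory

/-! ### Conditional laws -/

namespace ProbabilityTheory

section CondLaw

variable {Ω φ δ τ ζ 𝒴 : Type*} [MeasurableSpace Ω] [MeasurableSpace φ] [MeasurableSpace δ]
  [MeasurableSpace τ] [MeasurableSpace ζ] [MeasurableSpace 𝒴] {P : Measure Ω}

/-- Replacing `Y` by a sample from the kernel `κ` does not change its joint law with `F`. -/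
def IsCondLaw (P : Measure Ω) (κ : Kernel Ω 𝒴) (F : Ω → φ) (Y : Ω → 𝒴) : Prop :=
  (P ⊗ₘ κ).map (fun p => (F p.1, p.2)) = P.map (fun ω => (F ω, Y ω))

/-- The conditional law of `Y` given `D`, as a kernel on the sample space. -/
noncomputable def condLaw [StandardBorelSpace 𝒴] [Nonempty 𝒴] (P : Measure Ω) [IsFiniteMeasure P]
    (Y : Ω → 𝒴) (D : Ω → δ) (hD : Measurable D) : Kernel Ω 𝒴 :=
  (condDistrib Y D P).comap D hD

instance [StandardBorelSpace 𝒴] [Nonempty 𝒴] [IsFiniteMeasure P]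
    (Y : Ω → 𝒴) (D : Ω → δ) (hD : Measurable D) : IsMarkovKernel (condLaw P Y D hD) := by
  unfold condLaw; infer_instance

theorem map_compProd_comap [SFinite P] {F : Ω → φ} (hF : Measurable F) (κ : Kernel φ 𝒴)
    [IsMarkovKernel κ] :
    (P ⊗ₘ κ.comap F hF).map (fun p => (F p.1, p.2)) = P.map F ⊗ₘ κ := by
  ext s hs
  rw [Measure.map_apply (by fun_prop) hs,
    Measure.compProd_apply (hs.preimage (by fun_prop)), Measure.compProd_apply hs,
    lintegral_map (Kernel.measurable_kernel_prodMk_left hs) hF]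
  rfl

theorem IsCondLaw.comp {κ : Kernel Ω 𝒴} {F : Ω → φ} {Y : Ω → 𝒴} (h : IsCondLaw P κ F Y)
    (hF : Measurable F) (hY : Measurable Y) {g : φ → τ} (hg : Measurable g) :
    IsCondLaw P κ (fun ω => g (F ω)) Y := by
  have h1 := congrArg (Measure.map (fun p : φ × 𝒴 => (g p.1, p.2))) h
  rwa [Measure.map_map (by fun_prop) (by fun_prop), Measure.map_map (by fun_prop) (by fun_prop)]
    at h1

theorem IsCondLaw.congr {κ κ' : Kernel Ω 𝒴} {F : Ω → φ} {Y : Ω → 𝒴} (h : IsCondLaw P κ F Y)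
    (hκ : P ⊗ₘ κ = P ⊗ₘ κ') : IsCondLaw P κ' F Y := by
  unfold IsCondLaw; rw [← hκ]; exact h

/-- Uniqueness of conditional laws. Both kernels must factor through `F`: `IsCondLaw` constrains an
arbitrary kernel on `Ω` only after averaging over the fibres of `F`. -/
theorem compProd_comap_eq_of_isCondLaw [MeasurableSpace.CountablyGenerated 𝒴] [IsFiniteMeasure P]
    {Y : Ω → 𝒴} {F : Ω → φ} (hF : Measurable F)
    {κ η : Kernel φ 𝒴} [IsMarkovKernel κ] [IsMarkovKernel η]
    (h1 : IsCondLaw P (κ.comap F hF) F Y) (h2 : IsCondLaw P (η.comap F hF) F Y) :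
    P ⊗ₘ κ.comap F hF = P ⊗ₘ η.comap F hF := by
  have h : P.map F ⊗ₘ κ = P.map F ⊗ₘ η := by
    rw [← map_compProd_comap hF, ← map_compProd_comap hF]; exact h1.trans h2.symm
  refine Measure.compProd_congr ?_
  have h3 := ae_of_ae_map hF.aemeasurable (Kernel.ae_eq_of_compProd_eq h)
  filter_upwards [h3] with ω hω using hω

section StandardBorel

variable [StandardBorelSpace 𝒴] [Nonempty 𝒴] [IsProbabilityMeasure P]

theorem isCondLaw_condLaw {Y : Ω → 𝒴} (hY : Measurable Y) {D : Ω → δ} (hD : Measurable D) :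
    IsCondLaw P (condLaw P Y D hD) D Y := by
  unfold IsCondLaw condLaw
  rw [map_compProd_comap hD, compProd_map_condDistrib hY.aemeasurable]

/-- If, given `D`, the law of `Y` does not change when the finer variable `T` is known, then the
conditional laws of `Y` given `T` and given `D` agree. -/
theorem compProd_condLaw_eq {Y : Ω → 𝒴} (hY : Measurable Y) {T : Ω → τ} (hT : Measurable T)
    {D : Ω → δ} (hD : Measurable D) {e : τ → δ} (he : Measurable e) (heD : ∀ ω, D ω = e (T ω))
    {κ : Kernel δ 𝒴} [IsMarkovKernel κ] (h : IsCondLaw P (κ.comap D hD) T Y) :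
    P ⊗ₘ condLaw P Y T hT = P ⊗ₘ κ.comap D hD := by
  have h1 : κ.comap D hD = (κ.comap e he).comap T hT := by
    ext ω : 1; simp [Kernel.comap_apply, heD]
  rw [h1] at h ⊢
  exact compProd_comap_eq_of_isCondLaw hT (isCondLaw_condLaw hY hT) h

/-- The conditional law given `D` depends on `D` only through the information it carries. -/
theorem compProd_condLaw_congr {Y : Ω → 𝒴} (hY : Measurable Y) {T : Ω → τ} (hT : Measurable T)
    {D : Ω → δ} (hD : Measurable D) {e : τ → δ} (he : Measurable e) (heD : ∀ ω, D ω = e (T ω))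
    {e' : δ → τ} (he' : Measurable e') (heT : ∀ ω, T ω = e' (D ω)) :
    P ⊗ₘ condLaw P Y T hT = P ⊗ₘ condLaw P Y D hD := by
  refine compProd_condLaw_eq hY hT hD he heD ?_
  have h := (isCondLaw_condLaw (P := P) hY hD).comp hD hY he'
  rwa [← funext heT] at h

/-- The working form of conditional independence: the law of `Y` given `D` remains valid once `Z` is
also known. -/
theorem condIndepFun_iff_isCondLaw [StandardBorelSpace Ω] [StandardBorelSpace ζ] [Nonempty ζ]
    {Y : Ω → 𝒴} (hY : Measurable Y) {Z : Ω → ζ} (hZ : Measurable Z) {D : Ω → δ}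
    (hD : Measurable D) :
    Z ⟂ᵢ[D, hD; P] Y ↔ IsCondLaw P (condLaw P Y D hD) (fun ω => (D ω, Z ω)) Y := by
  have h1 : condLaw P Y D hD =
      ((condDistrib Y D P).prodMkRight ζ).comap (fun ω => (D ω, Z ω)) (hD.prodMk hZ) := by
    ext ω : 1; simp [condLaw, Kernel.comap_apply, Kernel.prodMkRight_apply]
  rw [condIndepFun_iff_condDistrib_prod_ae_eq_prodMkRight hY hZ hD,
    condDistrib_ae_eq_iff_measure_eq_compProd _ hY.aemeasurable, IsCondLaw, h1]
  have h2 := map_compProd_comap (P := P) (hD.prodMk hZ) ((condDistrib Y D P).prodMkRight ζ)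
  exact ⟨fun h => h2.trans h.symm, fun h => h.symm.trans h2⟩

/-- Conditional independence given `D` passes to any variable between `D` and `(D, Y)`. -/
theorem isCondLaw_swap [StandardBorelSpace Ω] [StandardBorelSpace ζ] [Nonempty ζ]
    {Y : Ω → 𝒴} (hY : Measurable Y) {Z : Ω → ζ} (hZ : Measurable Z) {D : Ω → δ}
    (hD : Measurable D) {E : Ω → φ} {e : δ → φ} (he : Measurable e)
    (heE : ∀ ω, E ω = e (D ω)) {η : Kernel φ ζ} [IsMarkovKernel η] (hE : Measurable E)
    (h : IsCondLaw P (η.comap E hE) (fun ω => (D ω, Y ω)) Z) :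
    IsCondLaw P (condLaw P Y D hD) (fun ω => (D ω, Z ω)) Y := by
  rw [← condIndepFun_iff_isCondLaw hY hZ hD]
  refine CondIndepFun.symm ?_
  rw [condIndepFun_iff_isCondLaw hZ hY hD]
  -- Since `E` is a function of `D`, the kernel in `h` is also the law of `Z` given `D`; thus `h`
  -- says that `Z` and `Y` are independent given `D`, which is symmetric.
  refine h.congr (compProd_condLaw_eq hZ hD hE he heE ?_).symm
  exact h.comp (hD.prodMk hY) hZ measurable_fst

end StandardBorel

/-- If the noise `W` is independent of `V`, then `κ`, the law of `h (V, W)` for frozen `V`, is a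
conditional law given `V`. -/
theorem isCondLaw_of_indepFun [IsProbabilityMeasure P] {V : Ω → φ} (hV : Measurable V) {W : Ω → ζ}
    (hW : Measurable W) (hind : IndepFun V W P) {h : φ → ζ → 𝒴}
    (hh : Measurable (Function.uncurry h)) (κ : Kernel Ω 𝒴) [IsMarkovKernel κ]
    (hκ : ∀ ω, κ ω = (P.map W).map (h (V ω))) :
    IsCondLaw P κ V (fun ω => h (V ω) (W ω)) := by
  have hhW : Measurable fun ω => h (V ω) (W ω) := hh.comp (hV.prodMk hW)
  have : IsProbabilityMeasure (P.map W) := Measure.isProbabilityMeasure_map hW.aemeasurable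
  have hm : Measurable fun p : φ × ζ => (p.1, h p.1 p.2) := measurable_fst.prodMk hh
  ext s hs
  have h1 : P.map (fun ω => (V ω, h (V ω) (W ω))) =
      ((P.map V).prod (P.map W)).map (fun p => (p.1, h p.1 p.2)) := by
    rw [← hind.map_prod_eq_prod_map_map hV.aemeasurable hW.aemeasurable,
      Measure.map_map hm (hV.prodMk hW)]
    rfl
  have hs' : MeasurableSet ((fun p : φ × ζ => (p.1, h p.1 p.2)) ⁻¹' s) :=
    hm hs
  rw [h1, Measure.map_apply (by fun_prop) hs, Measure.map_apply hm hs,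
    Measure.compProd_apply (hs.preimage (by fun_prop)), Measure.prod_apply hs',
    lintegral_map (measurable_measure_prodMk_left hs') hV]
  refine lintegral_congr fun ω => ?_
  have hsω : MeasurableSet (Prod.mk (V ω) ⁻¹' s) := measurable_prodMk_left hs
  rw [hκ]
  exact Measure.map_apply (hh.comp measurable_prodMk_left) hsω

/-- A function of `E` and of noise that is independent of `(E, A)` is conditionally independent of
`A` given `E`. -/
theorem condIndepFun_of_indepFun_noise [StandardBorelSpace Ω] [IsProbabilityMeasure P]
    [StandardBorelSpace 𝒴] [Nonempty 𝒴] [StandardBorelSpace ζ] [Nonempty ζ]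
    {E : Ω → φ} (hE : Measurable E) {A : Ω → ζ} (hA : Measurable A)
    {N : Ω → τ} (hN : Measurable N) (hind : IndepFun (fun ω => (E ω, A ω)) N P)
    {g : φ → τ → 𝒴} (hg : Measurable (Function.uncurry g)) :
    A ⟂ᵢ[E, hE; P] (fun ω => g (E ω) (N ω)) := by
  have hgN : Measurable fun ω => g (E ω) (N ω) := hg.comp (hE.prodMk hN)
  have : IsProbabilityMeasure (P.map N) := Measure.isProbabilityMeasure_map hN.aemeasurable
  rw [condIndepFun_iff_isCondLaw hgN hA hE]
  let κ : Kernel φ 𝒴 := (Kernel.id ×ₖ Kernel.const φ (P.map N)).map (Function.uncurry g)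
  have : IsMarkovKernel κ := Kernel.IsMarkovKernel.map _ hg
  have hκ : ∀ x, κ x = (P.map N).map (g x) := fun x => by
    simp only [κ]
    rw [Kernel.map_apply _ hg, Kernel.prod_apply, Kernel.id_apply, Kernel.const_apply,
      Measure.dirac_prod, Measure.map_map hg measurable_prodMk_left]
    rfl
  have h1 := isCondLaw_of_indepFun (hE.prodMk hA) hN hind (h := fun v n => g v.1 n)
    (hg.comp ((measurable_fst.comp measurable_fst).prodMk measurable_snd))
    (κ.comap E hE) (fun ω => hκ _)
  -- The conditional law found given `(E, A)` reads only `E`, so it is the conditional law given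
  -- `E`.
  refine h1.congr (compProd_condLaw_eq hgN hE hE measurable_id (fun _ => rfl) ?_).symm
  exact h1.comp (hE.prodMk hA) hgN measurable_fst

end CondLaw

end ProbabilityTheory

/-! ### Conditional mutual information and prediction errors -/

namespace ProbabilityTheory

variable {Ω φ δ ζ 𝒴 : Type*} [MeasurableSpace Ω] [MeasurableSpace φ] [MeasurableSpace δ]
  [MeasurableSpace ζ] [MeasurableSpace 𝒴] {P : Measure Ω}

/-- Tonelli: two draws that are independent given the base point may be made in either order. -/
theorem compProd_compProd_comap_fst_swap (μ : Measure φ) [IsFiniteMeasure μ] (κ : Kernel φ 𝒴)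
    (ρ : Kernel φ ζ) [IsMarkovKernel κ] [IsMarkovKernel ρ] :
    (μ ⊗ₘ κ) ⊗ₘ ρ.comap Prod.fst measurable_fst =
      ((μ ⊗ₘ ρ) ⊗ₘ κ.comap Prod.fst measurable_fst).map (fun p => ((p.1.1, p.2), p.1.2)) := by
  ext s hs
  have hs' : MeasurableSet ((fun p : (φ × ζ) × 𝒴 => ((p.1.1, p.2), p.1.2)) ⁻¹' s) :=
    hs.preimage (by fun_prop)
  rw [Measure.map_apply (by fun_prop) hs, Measure.compProd_apply hs, Measure.compProd_apply hs',
    Measure.lintegral_compProd (Kernel.measurable_kernel_prodMk_left hs),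
    Measure.lintegral_compProd (Kernel.measurable_kernel_prodMk_left hs')]
  refine lintegral_congr fun x => ?_
  have hx : MeasurableSet ((fun q : 𝒴 × ζ => ((x, q.1), q.2)) ⁻¹' s) :=
    hs.preimage (by fun_prop)
  exact (Measure.prod_apply (μ := κ x) (ν := ρ x) hx).symm.trans (Measure.prod_apply_symm hx)

/-- Rewrites the reference measure of `condMutualInfo` as a prediction of `Y` from `(C, E)` that
ignores `E`. -/
theorem compProd_prod_eq_map (μ : Measure φ) [IsFiniteMeasure μ] (κ : Kernel φ 𝒴)
    (ρ : Kernel φ ζ) [IsMarkovKernel κ] [IsMarkovKernel ρ] :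
    μ ⊗ₘ (κ ×ₖ ρ) =
      ((μ ⊗ₘ ρ) ⊗ₘ κ.comap Prod.fst measurable_fst).map (fun p => (p.1.1, (p.2, p.1.2))) := by
  ext s hs
  have hs' : MeasurableSet ((fun p : (φ × ζ) × 𝒴 => (p.1.1, (p.2, p.1.2))) ⁻¹' s) :=
    hs.preimage (by fun_prop)
  rw [Measure.map_apply (by fun_prop) hs, Measure.compProd_apply hs, Measure.compProd_apply hs',
    Measure.lintegral_compProd (Kernel.measurable_kernel_prodMk_left hs')]
  refine lintegral_congr fun x => ?_
  rw [Kernel.prod_apply, Measure.prod_apply_symm (measurable_prodMk_left hs)]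
  rfl

/-- If `κ₀` predicts `Y` and its law given `F` is `κ₁`, then the divergence of `κ₀` from a
prediction based on `F` is the divergence from `κ₁` plus the divergence of `κ₁`. -/
theorem klDiv_compProd_comap_eq_add [StandardBorelSpace Ω] [IsProbabilityMeasure P]
    {F : Ω → φ} (hF : Measurable F) (κ₀ : Kernel Ω 𝒴) [IsMarkovKernel κ₀]
    (κ₁ κ₂ : Kernel φ 𝒴) [IsMarkovKernel κ₁] [IsMarkovKernel κ₂]
    (h : (P ⊗ₘ κ₀).map (fun p => (F p.1, p.2)) = P.map F ⊗ₘ κ₁) :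
    klDiv (P ⊗ₘ κ₀) (P ⊗ₘ κ₂.comap F hF) =
      klDiv (P ⊗ₘ κ₀) (P ⊗ₘ κ₁.comap F hF) + klDiv (P.map F ⊗ₘ κ₁) (P.map F ⊗ₘ κ₂) := by
  have : Nonempty Ω := nonempty_of_isProbabilityMeasure P
  have : IsProbabilityMeasure (P.map F) := Measure.isProbabilityMeasure_map hF.aemeasurable
  let ι : Ω × 𝒴 → (φ × 𝒴) × Ω := fun p => ((F p.1, p.2), p.1)
  have hι : Measurable ι := by fun_prop
  let r : (φ × 𝒴) × Ω → Ω × 𝒴 := fun p => (p.2, p.1.2)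
  have hr : Measurable r := by fun_prop
  have hrι : Function.LeftInverse r ι := fun p => rfl
  -- Resampling `ω` given `F ω` does not involve the predictor of `Y`. After the embedding `ι`,
  -- every prediction based on `F` therefore ends with the same kernel `ρ`, and the chain rule
  -- separates the comparison on `φ × 𝒴` from a remainder common to `κ₁` and `κ₂`.
  let ρ : Kernel (φ × 𝒴) Ω := (condDistrib id F P).comap Prod.fst measurable_fst
  have key : ∀ (κ : Kernel φ 𝒴) [IsMarkovKernel κ],
      (P ⊗ₘ κ.comap F hF).map ι = (P.map F ⊗ₘ κ) ⊗ₘ ρ := fun κ _ => by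
    have h1 : κ.comap F hF = (κ.comap (Prod.fst : φ × Ω → φ) measurable_fst).comap
        (fun ω => (F ω, id ω)) (hF.prodMk measurable_id) := by
      ext ω : 1; simp [Kernel.comap_apply]
    rw [compProd_compProd_comap_fst_swap, compProd_map_condDistrib aemeasurable_id,
      ← map_compProd_comap (hF.prodMk measurable_id), ← h1, Measure.map_map (by fun_prop)
      (by fun_prop)]
    rfl
  have hfst : ((P ⊗ₘ κ₀).map ι).fst = P.map F ⊗ₘ κ₁ := by
    rw [← h, Measure.fst, Measure.map_map measurable_fst hι]; rfl
  have : IsProbabilityMeasure ((P ⊗ₘ κ₀).map ι) :=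
    Measure.isProbabilityMeasure_map hι.aemeasurable
  have hdis := ((P ⊗ₘ κ₀).map ι).disintegrate ((P ⊗ₘ κ₀).map ι).condKernel
  rw [hfst] at hdis
  rw [← klDiv_map_of_leftInverse _ _ hι hr hrι, key κ₂,
    ← klDiv_map_of_leftInverse (P ⊗ₘ κ₀) (P ⊗ₘ κ₁.comap F hF) hι hr hrι, key κ₁, ← hdis,
    klDiv_compProd_eq_add, add_comm]

/-- Chain rule: knowing `E` in addition to `C` improves the prediction of `Y` by `I(Y; E | C)`. -/
theorem klDiv_compProd_condLaw_eq_add [StandardBorelSpace Ω] [IsProbabilityMeasure P]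
    [StandardBorelSpace 𝒴] [Nonempty 𝒴] [StandardBorelSpace ζ] [Nonempty ζ]
    {Y : Ω → 𝒴} (hY : Measurable Y) {E : Ω → ζ} (hE : Measurable E) {C : Ω → δ}
    (hC : Measurable C) (κ₀ : Kernel Ω 𝒴) [IsMarkovKernel κ₀]
    (h : IsCondLaw P κ₀ (fun ω => (C ω, E ω)) Y) :
    klDiv (P ⊗ₘ κ₀) (P ⊗ₘ condLaw P Y C hC) =
      klDiv (P ⊗ₘ κ₀) (P ⊗ₘ condLaw P Y (fun ω => (C ω, E ω)) (hC.prodMk hE)) +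
        condMutualInfo Y E C P := by
  have h1 : condLaw P Y C hC = ((condDistrib Y C P).comap (Prod.fst : δ × ζ → δ)
      measurable_fst).comap (fun ω => (C ω, E ω)) (hC.prodMk hE) := by
    ext ω : 1; simp [condLaw, Kernel.comap_apply]
  have h2 : P.map (fun ω => (C ω, (Y ω, E ω))) =
      (P.map (fun ω => ((C ω, E ω), Y ω))).map (fun p => (p.1.1, (p.2, p.1.2))) := by
    rw [Measure.map_map (by fun_prop) (by fun_prop)]; rfl
  have : IsProbabilityMeasure (P.map C) := Measure.isProbabilityMeasure_map hC.aemeasurable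
  rw [h1, klDiv_compProd_comap_eq_add (hC.prodMk hE) κ₀
      (condDistrib Y (fun ω => (C ω, E ω)) P) _
      (h.trans (compProd_map_condDistrib hY.aemeasurable).symm), condMutualInfo, h2,
    compProd_prod_eq_map, compProd_map_condDistrib hE.aemeasurable,
    klDiv_map_of_leftInverse _ _ (h := fun p => ((p.1, p.2.2), p.2.1)) (by fun_prop) (by fun_prop)
      (fun _ => rfl), compProd_map_condDistrib hY.aemeasurable]
  rfl

end ProbabilityTheory

/-! ### Telescoping over the layers -/

section Layers

variable {K : ℕ} {Ω 𝒳 𝒴 : Type*} [MeasurableSpace Ω] [MeasurableSpace 𝒳] [MeasurableSpace 𝒴]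
  {Θ Z : Fin K → Type*} [∀ k, MeasurableSpace (Θ k)] [∀ k, Nonempty (Θ k)]
  [∀ k, MeasurableSpace (Z k)] [∀ k, Nonempty (Z k)]

/-- The first `n` proxies, the environments of the other layers, and the input. -/
noncomputable def mixedLayers (E : ∀ k, Ω → Θ k) (A : ∀ k, Ω → Z k) (X : Ω → 𝒳) (n : ℕ) (ω : Ω) :
    (∀ k, Θ k × Z k) × 𝒳 :=
  -- Constant placeholders carry no information and keep the type independent of `n`.
  (fun j => (if n ≤ j then E j ω else Classical.arbitrary _,
    if (j : ℕ) < n then A j ω else Classical.arbitrary _), X ω)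

variable {E : ∀ k, Ω → Θ k} {A : ∀ k, Ω → Z k} {X : Ω → 𝒳} {Y : Ω → 𝒴}

theorem measurable_mixedLayers (hE : ∀ k, Measurable (E k)) (hA : ∀ k, Measurable (A k))
    (hX : Measurable X) (n : ℕ) : Measurable (mixedLayers E A X n) := by
  refine Measurable.prodMk (measurable_pi_lambda _ fun j => Measurable.prodMk ?_ ?_) hX
  · split_ifs
    exacts [hE j, measurable_const]
  · split_ifs
    exacts [hA j, measurable_const]

/-- The variables on which the contribution of layer `k` is conditioned. -/
def layerContext (E : ∀ k, Ω → Θ k) (A : ∀ k, Ω → Z k) (X : Ω → 𝒳) (k : Fin K) (ω : Ω) :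
    (∀ j : {j // k < j}, Θ j) × (∀ j : {j // j ≤ k}, Z j) × 𝒳 :=
  ((fun j => E j ω), (fun j => A j ω), X ω)

omit [∀ k, Nonempty (Θ k)] [∀ k, Nonempty (Z k)] in
theorem measurable_layerContext (hE : ∀ k, Measurable (E k)) (hA : ∀ k, Measurable (A k))
    (hX : Measurable X) (k : Fin K) : Measurable (layerContext E A X k) := by
  unfold layerContext
  exact (measurable_pi_lambda _ fun j => hE j.1).prodMk
    ((measurable_pi_lambda _ fun j => hA j.1).prodMk hX)

theorem measurable_cast_index {ι γ : Type*} [MeasurableSpace γ] {α : ι → Type*}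
    [∀ i, MeasurableSpace (α i)] {i j : ι} (h : i = j) {f : γ → α i} (hf : Measurable f) :
    Measurable fun c => cast (congrArg α h) (f c) := by
  subst h; exact hf

variable {P : Measure Ω} [IsProbabilityMeasure P] [StandardBorelSpace 𝒴] [Nonempty 𝒴]

/-- The two conditioning variables differ only by placeholders, so each is a function of the other.
-/
theorem compProd_condLaw_layerContext (hE : ∀ k, Measurable (E k)) (hA : ∀ k, Measurable (A k))
    (hX : Measurable X) (hY : Measurable Y) (k : Fin K) :
    P ⊗ₘ condLaw P Y (layerContext E A X k) (measurable_layerContext hE hA hX k) =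
      P ⊗ₘ condLaw P Y (mixedLayers E A X (k + 1)) (measurable_mixedLayers hE hA hX _) := by
  refine compProd_condLaw_congr hY _ _
    (e := fun c => ((fun j => (if h : k < j then c.1 ⟨j, h⟩ else Classical.arbitrary _,
      if h : j ≤ k then c.2.1 ⟨j, h⟩ else Classical.arbitrary _)), c.2.2))
    (e' := fun d => ((fun j => (d.1 j).1), (fun j => (d.1 j).2), d.2)) ?_ ?_ ?_ ?_
  · refine Measurable.prodMk (measurable_pi_lambda _ fun j => Measurable.prodMk ?_ ?_)
      (by fun_prop)
    · split_ifs
      exacts [by fun_prop, measurable_const]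
    · split_ifs
      exacts [by fun_prop, measurable_const]
  · intro ω
    simp only [mixedLayers, layerContext, Prod.mk.injEq, and_true]
    funext j
    by_cases h : k < j
    · have h1 : (k : ℕ) + 1 ≤ j := h
      simp [h, h1, not_le.2 h]
    · have h1 : ¬ (k : ℕ) + 1 ≤ j := h
      simp [h, h1, not_lt.1 h, Nat.lt_of_not_le h1]
  · fun_prop
  · intro ω
    simp only [mixedLayers, layerContext, Prod.mk.injEq, and_true]
    refine ⟨funext fun j => ?_, funext fun j => ?_⟩
    · have h1 : (k : ℕ) + 1 ≤ j.1 := j.2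
      simp [h1]
    · have h1 : (j.1 : ℕ) < k + 1 := Nat.lt_succ_of_le j.2
      simp [h1]

variable [StandardBorelSpace Ω] [StandardBorelSpace 𝒳] [∀ k, StandardBorelSpace (Θ k)]
  [∀ k, StandardBorelSpace (Z k)]

/-- The left side conditions on one more variable than the right, namely `A k`. Given `E k`, which
both contain, `A k` is independent of everything else, so it does not help to predict `Y`. -/
theorem compProd_condLaw_layerContext_env (hE : ∀ k, Measurable (E k))
    (hA : ∀ k, Measurable (A k)) (hX : Measurable X) (hY : Measurable Y) (k : Fin K)
    (hci : A k ⟂ᵢ[E k, hE k; P]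
      (fun ω => ((fun j : {j // j ≠ k} => E j ω), (fun j : {j // j ≠ k} => A j ω), X ω, Y ω))) :
    P ⊗ₘ condLaw P Y (fun ω => (layerContext E A X k ω, E k ω))
        ((measurable_layerContext hE hA hX k).prodMk (hE k)) =
      P ⊗ₘ condLaw P Y (mixedLayers E A X k) (measurable_mixedLayers hE hA hX _) := by
  have : Nonempty Ω := nonempty_of_isProbabilityMeasure P
  have : Nonempty 𝒳 := ‹Nonempty Ω›.map X
  have hR : Measurable fun ω => ((fun j : {j // j ≠ k} => E j ω),
      (fun j : {j // j ≠ k} => A j ω), X ω, Y ω) :=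
    (measurable_pi_lambda _ fun j => hE j.1).prodMk
      ((measurable_pi_lambda _ fun j => hA j.1).prodMk (hX.prodMk hY))
  have hD := measurable_mixedLayers hE hA hX k
  have h1 := (condIndepFun_iff_isCondLaw (hA k) hR (hE k)).1 hci.symm
  -- `mixedLayers E A X k` contains `E k` but not `A k`, so together with `Y` it is a function of `E
  -- k` and of the variables in `hci`; the cast inserts `E k` in slot `k`.
  have h2 : IsCondLaw P (condLaw P (A k) (E k) (hE k))
      (fun ω => (mixedLayers E A X k ω, Y ω)) (A k) := by
    have h3 := h1.comp ((hE k).prodMk hR) (hA k)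
      (g := fun q => (((fun j => (if k ≤ j then (if h : j = k then cast (congrArg Θ h.symm) q.1 else q.2.1 ⟨j, h⟩)
        else Classical.arbitrary _,
        if h : j < k then q.2.2.1 ⟨j, h.ne⟩ else Classical.arbitrary _)), q.2.2.2.1),
        q.2.2.2.2)) ?_
    · convert h3 using 2 with ω
      simp only [mixedLayers, Prod.mk.injEq, and_true]
      funext j
      rcases lt_trichotomy j k with h | h | h
      · simp [h, not_le.2 h]
      · subst h; simp
      · simp [h.le, h.ne', not_lt.2 h.le]
    · refine ((measurable_pi_lambda _ fun j => Measurable.prodMk ?_ ?_).prodMk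
        (by fun_prop)).prodMk (by fun_prop)
      · split_ifs with h h'
        exacts [measurable_cast_index h'.symm measurable_fst, by fun_prop, measurable_const]
      · split_ifs
        exacts [by fun_prop, measurable_const]
  -- By symmetry the law of `Y` given the mixed layers is unchanged when `A k` is revealed; `h5` and
  -- `h6` read this with `(layerContext, E k)` as the known variable.
  have h4 := isCondLaw_swap hY (hA k) hD (e := fun d => (d.1 k).1) (by fun_prop)
    (fun ω => by simp [mixedLayers]) (hE k) h2
  have h5 := h4.comp (hD.prodMk (hA k)) hY
    (g := fun q : ((∀ k, Θ k × Z k) × 𝒳) × Z k => ((((fun j : {j // k < j} => (q.1.1 j).1),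
      (fun j : {j // j ≤ k} => if h : j.1 = k then cast (congrArg Z h.symm) q.2 else (q.1.1 j).2), q.1.2) :
        (∀ j : {j // k < j}, Θ j) × (∀ j : {j // j ≤ k}, Z j) × 𝒳), (q.1.1 k).1)) ?_
  swap
  · refine ((measurable_pi_lambda _ fun j => by fun_prop).prodMk
      ((measurable_pi_lambda _ fun j => ?_).prodMk (by fun_prop))).prodMk (by fun_prop)
    split_ifs with h'
    exacts [measurable_cast_index h'.symm measurable_snd, by fun_prop]
  have h6 : (fun ω => (((fun j : {j // k < j} => ((mixedLayers E A X k ω).1 j).1),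
      (fun j : {j // j ≤ k} => if h : j.1 = k then cast (congrArg Z h.symm) (A k ω) else
        ((mixedLayers E A X k ω).1 j).2), (mixedLayers E A X k ω).2),
        ((mixedLayers E A X k ω).1 k).1)) = fun ω => (layerContext E A X k ω, E k ω) := by
    funext ω
    simp only [mixedLayers, layerContext, Prod.mk.injEq, and_true, le_refl, if_true]
    refine ⟨funext fun j => ?_, funext fun j => ?_⟩
    · simp [j.2.le]
    · obtain ⟨j, hj⟩ := j
      rcases hj.lt_or_eq with h | h
      · simp [h, h.ne]
      · subst h; simp
  rw [h6] at h5
  refine compProd_condLaw_eq hY _ _ (κ := condDistrib Y (mixedLayers E A X k) P)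
    (e := fun q => ((fun j => (if h : k < j then q.1.1 ⟨j, h⟩ else
      if h : j = k then cast (congrArg Θ h.symm) q.2 else Classical.arbitrary _,
      if h : j < k then q.1.2.1 ⟨j, h.le⟩ else Classical.arbitrary _)), q.1.2.2)) ?_ ?_ h5
  · refine (measurable_pi_lambda _ fun j => Measurable.prodMk ?_ ?_).prodMk (by fun_prop)
    · split_ifs with h h'
      exacts [by fun_prop, measurable_cast_index h'.symm measurable_snd, measurable_const]
    · split_ifs
      exacts [by fun_prop, measurable_const]
  · intro ω
    simp only [mixedLayers, layerContext, Prod.mk.injEq, and_true]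
    funext j
    rcases lt_trichotomy j k with h | h | h
    · simp [h, not_le.2 h, not_lt.2 h.le, h.ne]
    · subst h; simp
    · simp [h, h.le, not_lt.2 h.le]

/-- The expected error of the prediction from all proxies is at most the sum of the contributions
of the layers. -/
theorem lintegral_klDiv_le_sum_condMutualInfo (hE : ∀ k, Measurable (E k))
    (hA : ∀ k, Measurable (A k)) (hX : Measurable X) (hY : Measurable Y)
    (κ : Kernel ((∀ k, Θ k) × 𝒳) 𝒴) [IsMarkovKernel κ]
    (hEX : Measurable fun ω => ((fun k => E k ω), X ω))
    (hκ : IsCondLaw P (κ.comap _ hEX) (fun ω => ((fun k => E k ω), (fun k => A k ω), X ω)) Y)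
    (hci : ∀ k, A k ⟂ᵢ[E k, hE k; P]
      (fun ω => ((fun j : {j // j ≠ k} => E j ω), (fun j : {j // j ≠ k} => A j ω), X ω, Y ω))) :
    ∫⁻ ω, klDiv (κ ((fun k => E k ω), X ω))
        (condDistrib Y (fun ω' => ((fun k => A k ω'), X ω')) P ((fun k => A k ω), X ω)) ∂P ≤
      ∑ k, condMutualInfo Y (E k) (layerContext E A X k) P := by
  have hEAX : Measurable fun ω => ((fun k => E k ω), (fun k => A k ω), X ω) :=
    (measurable_pi_lambda _ hE).prodMk ((measurable_pi_lambda _ hA).prodMk hX)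
  have hAX : Measurable fun ω => ((fun k => A k ω), X ω) :=
    (measurable_pi_lambda _ hA).prodMk hX
  have hD := measurable_mixedLayers hE hA hX
  have hstep : ∀ k : Fin K,
      klDiv (P ⊗ₘ κ.comap _ hEX) (P ⊗ₘ condLaw P Y (mixedLayers E A X (k + 1)) (hD _)) =
      klDiv (P ⊗ₘ κ.comap _ hEX) (P ⊗ₘ condLaw P Y (mixedLayers E A X k) (hD _)) +
        condMutualInfo Y (E k) (layerContext E A X k) P := fun k => by
    rw [← compProd_condLaw_layerContext hE hA hX hY k,
      ← compProd_condLaw_layerContext_env hE hA hX hY k (hci k)]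
    refine klDiv_compProd_condLaw_eq_add hY (hE k) _ _ ?_
    exact hκ.comp hEAX hY (g := fun q => (((fun j : {j // k < j} => q.1 j),
      (fun j : {j // j ≤ k} => q.2.1 j), q.2.2), q.1 k)) (by fun_prop)
  have hbase : P ⊗ₘ condLaw P Y (mixedLayers E A X 0) (hD _) = P ⊗ₘ κ.comap _ hEX := by
    refine compProd_condLaw_eq hY _ hEX (e := fun d => ((fun j => (d.1 j).1), d.2))
      (by fun_prop) (fun ω => by simp [mixedLayers]) ?_
    have h := hκ.comp hEAX hY (g := fun q => ((fun j => (q.1 j, (Classical.arbitrary (Z j)))),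
      q.2.2)) (by fun_prop)
    convert h using 2 with ω
    simp [mixedLayers]
  have hend : P ⊗ₘ condLaw P Y (mixedLayers E A X K) (hD _) = P ⊗ₘ condLaw P Y _ hAX := by
    refine compProd_condLaw_congr hY _ _ (e := fun d => ((fun j => (d.1 j).2), d.2))
      (by fun_prop) (fun ω => by simp [mixedLayers])
      (e' := fun d => ((fun j => (Classical.arbitrary (Θ j), d.1 j)), d.2)) (by fun_prop)
      (fun ω => by simp [mixedLayers, Nat.not_le.2 (Fin.is_lt _)])
  -- `hstep` is telescoped from `hbase`, where the divergence is zero.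
  have hsum : ∀ n (hn : n ≤ K),
      klDiv (P ⊗ₘ κ.comap _ hEX) (P ⊗ₘ condLaw P Y (mixedLayers E A X n) (hD _)) =
        ∑ k : Fin n, condMutualInfo Y (E (k.castLE hn)) (layerContext E A X (k.castLE hn)) P := by
    intro n
    induction n with
    | zero => intro _; simp [hbase]
    | succ n ih =>
      intro hn
      rw [Fin.sum_univ_castSucc, hstep ⟨n, hn⟩, ih (Nat.le_of_succ_le hn)]
      rfl
  have h := lintegral_klDiv_le_klDiv_compProd P (κ.comap _ hEX) (condLaw P Y _ hAX)
  rw [← hend, hsum K le_rfl] at h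
  exact h

end Layers

/-! ### Independence -/

namespace ProbabilityTheory

theorem IndepFun.prodMk_right_of_prodMk_left {Ω α β γ : Type*} [MeasurableSpace Ω]
    [MeasurableSpace α] [MeasurableSpace β] [MeasurableSpace γ] {P : Measure Ω}
    [IsProbabilityMeasure P] {a : Ω → α} {b : Ω → β} {c : Ω → γ} (ha : Measurable a)
    (hb : Measurable b) (hc : Measurable c) (hab : IndepFun a b P)
    (habc : IndepFun (fun ω => (a ω, b ω)) c P) : IndepFun a (fun ω => (b ω, c ω)) P := by
  have h1 : IndepFun b c P := habc.comp measurable_snd measurable_id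
  rw [indepFun_iff_map_prod_eq_prod_map_map ha.aemeasurable (hb.prodMk hc).aemeasurable,
    h1.map_prod_eq_prod_map_map hb.aemeasurable hc.aemeasurable]
  have h2 := habc.map_prod_eq_prod_map_map (ha.prodMk hb).aemeasurable hc.aemeasurable
  rw [hab.map_prod_eq_prod_map_map ha.aemeasurable hb.aemeasurable] at h2
  have : IsProbabilityMeasure (P.map a) := Measure.isProbabilityMeasure_map ha.aemeasurable
  have : IsProbabilityMeasure (P.map b) := Measure.isProbabilityMeasure_map hb.aemeasurable
  have : IsProbabilityMeasure (P.map c) := Measure.isProbabilityMeasure_map hc.aemeasurable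
  have h3 := congrArg (Measure.map MeasurableEquiv.prodAssoc) h2
  rw [(measurePreserving_prodAssoc (P.map a) (P.map b) (P.map c)).map_eq,
    Measure.map_map (MeasurableEquiv.measurable _) (by fun_prop)] at h3
  exact h3

/-- A coordinate of a product space is independent of the other coordinates. -/
theorem indepFun_eval_compl {ι : Type*} [Fintype ι] [DecidableEq ι] {α : ι → Type*}
    [∀ i, MeasurableSpace (α i)] (μ : ∀ i, Measure (α i)) [∀ i, IsProbabilityMeasure (μ i)]
    (k : ι) :
    IndepFun (fun a : ∀ i, α i => a k) (fun a (j : {j // j ≠ k}) => a j) (Measure.pi μ) := by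
  have h := (iIndepFun_pi (μ := μ) (X := fun _ => id)
    (fun _ => aemeasurable_id)).indepFun_finset {k} {k}ᶜ disjoint_compl_right
    (fun i => measurable_pi_apply i)
  have h1 : Measurable fun a : ∀ i : ({k} : Finset ι), α i => a ⟨k, by simp⟩ :=
    measurable_pi_apply (⟨k, by simp⟩ : ({k} : Finset ι))
  have h2 : Measurable fun (a : ∀ i : ({k}ᶜ : Finset ι), α i) (j : {j // j ≠ k}) =>
      a ⟨j.1, by simpa using j.2⟩ := measurable_pi_lambda _ fun j =>
    measurable_pi_apply (⟨j.1, by simpa using j.2⟩ : ({k}ᶜ : Finset ι))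
  exact h.comp h1 h2

end ProbabilityTheory

/-- The sample space of a proxy lives in universe `u`, whereas input and noise live in `Type`. -/
instance ULift.standardBorelSpace {α : Type*} [MeasurableSpace α] [StandardBorelSpace α] :
    StandardBorelSpace (ULift.{u} α) := by
  let := upgradeStandardBorel α
  have : PolishSpace (ULift.{u} α) := Homeomorph.ulift.isClosedEmbedding.polishSpace
  infer_instance

/-! ### Proxies of a single environment -/

namespace Environment.Proxy

variable {Θ : Type u} {𝒳 𝒴 : Type} [MeasurableSpace Θ] [MeasurableSpace 𝒳] [MeasurableSpace 𝒴]
  {𝓔 : Environment Θ 𝒳 𝒴} (p : 𝓔.Proxy)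

theorem map_env_X : p.P.map (fun ω => (p.env ω, p.X ω)) = 𝓔.prior.prod 𝓔.input := by
  have hX := p.measurable_X
  have hY := p.measurable_Y
  have hE := p.measurable_env
  have h := congrArg Measure.fst p.map_eq
  rwa [Environment.jointLaw, Measure.fst_compProd, Measure.fst,
    Measure.map_map measurable_fst (by fun_prop)] at h

theorem map_env : p.P.map p.env = 𝓔.prior := by
  have hX := p.measurable_X
  have hE := p.measurable_env
  have h := congrArg Measure.fst p.map_env_X
  rw [Measure.fst_prod, Measure.fst, Measure.map_map measurable_fst (by fun_prop)] at h
  exact h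

/-- The environment and its proxy are jointly independent of the input. -/
theorem map_env_proxy_X [StandardBorelSpace 𝒳] [StandardBorelSpace 𝒴] :
    p.P.map (fun ω => ((p.env ω, p.proxy ω), p.X ω)) =
      (p.P.map fun ω => (p.env ω, p.proxy ω)).prod 𝓔.input := by
  have hX := p.measurable_X
  have hY := p.measurable_Y
  have hE := p.measurable_env
  have hZ := p.measurable_proxy
  have : Nonempty p.Ω := nonempty_of_isProbabilityMeasure p.P
  have : Nonempty 𝒳 := ‹Nonempty p.Ω›.map p.X
  have : Nonempty p.Z := ‹Nonempty p.Ω›.map p.proxy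
  have h1 : p.proxy ⟂ᵢ[p.env, p.measurable_env; p.P] p.X :=
    p.condIndep.comp measurable_id measurable_fst
  rw [condIndepFun_iff_isCondLaw hX hZ hE] at h1
  have h2 : IsCondLaw p.P ((Kernel.const Θ 𝓔.input).comap p.env hE) p.env p.X := by
    rw [IsCondLaw, map_compProd_comap, map_env_X, map_env, Measure.compProd_const]
  have h3 := h1.congr (compProd_condLaw_eq hX hE hE measurable_id (fun _ => rfl) h2)
  have h4 : (Kernel.const Θ 𝓔.input).comap p.env hE =
      (Kernel.const (Θ × p.Z) 𝓔.input).comap (fun ω => (p.env ω, p.proxy ω)) (hE.prodMk hZ) := rfl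
  -- A constant kernel factors through any variable; read through `(env, proxy)`, it gives the
  -- product law.
  rw [h4] at h3
  have h5 := map_compProd_comap (P := p.P) (hE.prodMk hZ) (Kernel.const (Θ × p.Z) 𝓔.input)
  rw [Measure.compProd_const] at h5
  exact h3.symm.trans h5

end Environment.Proxy

/-! ### Gaussian channels -/

theorem gaussianChannel_apply {α : Type*} [MeasurableSpace α] {n : ℕ} (g : α → Fin n → ℝ)
    (hg : Measurable g) (σ2 : ℝ≥0) (a : α) :
    gaussianChannel g hg σ2 a = (gaussianNoise n σ2).map (fun w => g a + w) := by
  rw [gaussianChannel, Kernel.map_apply _ (by fun_prop), Kernel.prod_apply,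
    Kernel.deterministic_apply, Kernel.const_apply, Measure.dirac_prod,
    Measure.map_map (by fun_prop) (by fun_prop)]
  rfl

namespace MultilayerEnvironment

variable {K : ℕ} {dim : Fin (K + 1) → ℕ} {Θ : Fin K → Type u} [∀ k, MeasurableSpace (Θ k)]

/-- The output of the first `j` layers depends on these layers only. -/
theorem U_congr (M : MultilayerEnvironment dim Θ) (j : Fin (K + 1)) {θ θ' : ∀ k, Θ k}
    (x : Fin (dim 0) → ℝ) (h : ∀ k : Fin K, k.castSucc < j → θ k = θ' k) :
    M.U j θ x = M.U j θ' x := by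
  induction j using Fin.induction with
  | zero => rfl
  | succ k ih =>
    have h1 : ∀ θ : ∀ k, Θ k, M.U k.succ θ x = M.layer k (θ k) (M.U k.castSucc θ x) :=
      fun θ => by simp [U]
    rw [h1, h1, h k Fin.castSucc_lt_succ,
      ih fun i hi => h i (hi.trans Fin.castSucc_lt_succ)]

end MultilayerEnvironment

/-! ### Combining proxies of the layers -/

namespace MultilayerEnvironment

variable {K : ℕ} {dim : Fin (K + 1) → ℕ} {Θ : Fin K → Type u} [∀ k, MeasurableSpace (Θ k)]
  {M : MultilayerEnvironment dim Θ} (q : ∀ k, (M.layerEnvironment k).Proxy)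

/-- The sample space on which the layers, each with its proxy, the input and the noise live. -/
abbrev Combined (q : ∀ k, (M.layerEnvironment k).Proxy) : Type u :=
  (∀ k, (q k).Ω) × ULift.{u} ((Fin (dim 0) → ℝ) × (Fin (dim (Fin.last K)) → ℝ))

namespace Combined

/-- Each `(q k).Ω` also carries its own input and output; these are ignored, and layer inputs are
recomputed from the fresh input and the layers. -/
noncomputable def law : Measure (Combined q) :=
  (Measure.pi fun k => (q k).P).prod
    ((M.input.prod (gaussianNoise (dim (Fin.last K)) M.noiseVar)).map ULift.up)

instance : IsProbabilityMeasure (law q) := by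
  have : IsProbabilityMeasure
      ((M.input.prod (gaussianNoise (dim (Fin.last K)) M.noiseVar)).map ULift.up) :=
    Measure.isProbabilityMeasure_map measurable_up.aemeasurable
  unfold law; infer_instance

variable {q}

def env (k : Fin K) (ω : Combined q) : Θ k := (q k).env (ω.1 k)

def proxy (k : Fin K) (ω : Combined q) : (q k).Z := (q k).proxy (ω.1 k)

def X (ω : Combined q) : Fin (dim 0) → ℝ := ω.2.down.1

def W (ω : Combined q) : Fin (dim (Fin.last K)) → ℝ := ω.2.down.2

def Y (ω : Combined q) : Fin (dim (Fin.last K)) → ℝ :=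
  M.U (Fin.last K) (fun k => env k ω) (X ω) + W ω

theorem measurable_env (k : Fin K) : Measurable (env (q := q) k) :=
  (q k).measurable_env.comp ((measurable_pi_apply k).comp measurable_fst)

theorem measurable_proxy (k : Fin K) : Measurable (proxy (q := q) k) :=
  (q k).measurable_proxy.comp ((measurable_pi_apply k).comp measurable_fst)

theorem measurable_X : Measurable (X (q := q)) :=
  measurable_fst.comp (measurable_down.comp measurable_snd)

theorem measurable_W : Measurable (W (q := q)) :=
  measurable_snd.comp (measurable_down.comp measurable_snd)

theorem measurable_envs : Measurable fun (ω : Combined q) k => env k ω :=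
  measurable_pi_lambda _ measurable_env

theorem measurable_proxies : Measurable fun (ω : Combined q) k => proxy k ω :=
  measurable_pi_lambda _ measurable_proxy

theorem measurable_Y : Measurable (Y (q := q)) :=
  ((M.measurable_U _).comp (measurable_envs.prodMk measurable_X)).add measurable_W

theorem map_fst : (law q).map Prod.fst = Measure.pi fun k => (q k).P := by
  have : IsProbabilityMeasure
      ((M.input.prod (gaussianNoise (dim (Fin.last K)) M.noiseVar)).map ULift.up) :=
    Measure.isProbabilityMeasure_map measurable_up.aemeasurable
  exact Measure.fst_prod

theorem map_X_W : (law q).map (fun ω => (X ω, W ω)) =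
    M.input.prod (gaussianNoise (dim (Fin.last K)) M.noiseVar) := by
  have h : (law q).map Prod.snd =
      (M.input.prod (gaussianNoise (dim (Fin.last K)) M.noiseVar)).map ULift.up :=
    Measure.snd_prod
  have h1 := congrArg (Measure.map ULift.down) h
  rw [Measure.map_map measurable_down measurable_snd,
    Measure.map_map measurable_down measurable_up] at h1
  exact h1.trans Measure.map_id

theorem map_X : (law q).map X = M.input := by
  have h := congrArg Measure.fst (map_X_W (q := q))
  rwa [Measure.fst_prod, Measure.fst,
    Measure.map_map measurable_fst (measurable_X.prodMk measurable_W)] at h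

theorem map_W : (law q).map W = gaussianNoise (dim (Fin.last K)) M.noiseVar := by
  have h := congrArg Measure.snd (map_X_W (q := q))
  rwa [Measure.snd_prod, Measure.snd,
    Measure.map_map measurable_snd (measurable_X.prodMk measurable_W)] at h

theorem indepFun_fst_snd :
    IndepFun (Prod.fst : Combined q → _) Prod.snd (law q) := by
  have : IsProbabilityMeasure
      ((M.input.prod (gaussianNoise (dim (Fin.last K)) M.noiseVar)).map ULift.up) :=
    Measure.isProbabilityMeasure_map measurable_up.aemeasurable
  exact indepFun_prod measurable_id measurable_id

theorem indepFun_fst_X_W :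
    IndepFun (fun ω : Combined q => (ω.1, X ω)) W (law q) := by
  have h1 : IndepFun W X (law q) := by
    refine IndepFun.symm ?_
    rw [indepFun_iff_map_prod_eq_prod_map_map measurable_X.aemeasurable measurable_W.aemeasurable,
      map_X_W, map_X, map_W]
  have h2 : IndepFun (fun ω : Combined q => (W ω, X ω)) Prod.fst (law q) :=
    (indepFun_fst_snd.comp measurable_id (ψ := fun x => (x.down.2, x.down.1))
      (measurable_swap.comp measurable_down)).symm
  exact ((h1.prodMk_right_of_prodMk_left measurable_W measurable_X measurable_fst h2).comp
    measurable_id measurable_swap).symm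

/-- The source of randomness other than layer `k` and its proxy. -/
def others (k : Fin K) (ω : Combined q) : (∀ j : {j // j ≠ k}, (q j).Ω) ×
    ULift.{u} ((Fin (dim 0) → ℝ) × (Fin (dim (Fin.last K)) → ℝ)) :=
  (fun j => ω.1 j, ω.2)

theorem measurable_others (k : Fin K) : Measurable (others (q := q) k) :=
  (measurable_pi_lambda _ fun j => (measurable_pi_apply j.1).comp measurable_fst).prodMk
    measurable_snd

theorem indepFun_others (k : Fin K) :
    IndepFun (fun ω : Combined q => ω.1 k) (others k) (law q) := by
  have hk : Measurable fun a : ∀ k, (q k).Ω => a k := measurable_pi_apply k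
  have hr : Measurable fun (a : ∀ k, (q k).Ω) (j : {j // j ≠ k}) => a j :=
    measurable_pi_lambda _ fun j => measurable_pi_apply j.1
  refine IndepFun.prodMk_right_of_prodMk_left (hk.comp measurable_fst) (hr.comp measurable_fst)
    measurable_snd ?_ (indepFun_fst_snd.comp (hk.prodMk hr) measurable_id)
  have h := indepFun_eval_compl (fun k => (q k).P) k
  rw [indepFun_iff_map_prod_eq_prod_map_map hk.aemeasurable hr.aemeasurable, ← map_fst,
    Measure.map_map (hk.prodMk hr) measurable_fst, Measure.map_map hk measurable_fst,
    Measure.map_map hr measurable_fst] at h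
  exact (indepFun_iff_map_prod_eq_prod_map_map (hk.comp measurable_fst).aemeasurable
    (hr.comp measurable_fst).aemeasurable).2 h

theorem indepFun_env_proxy_others (k : Fin K) :
    IndepFun (fun ω : Combined q => (env k ω, proxy k ω)) (others k) (law q) :=
  (indepFun_others k).comp ((q k).measurable_env.prodMk (q k).measurable_proxy) measurable_id

theorem map_pi {α : Fin K → Type*} [∀ k, MeasurableSpace (α k)] {f : ∀ k, (q k).Ω → α k}
    (hf : ∀ k, Measurable (f k)) :
    (law q).map (fun ω k => f k (ω.1 k)) = Measure.pi fun k => (q k).P.map (f k) := by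
  have : ∀ k, IsProbabilityMeasure ((q k).P.map (f k)) := fun k =>
    Measure.isProbabilityMeasure_map (hf k).aemeasurable
  have hm : Measurable fun (a : ∀ k, (q k).Ω) k => f k (a k) :=
    measurable_pi_lambda _ fun k => (hf k).comp (measurable_pi_apply k)
  rw [← Measure.pi_map_pi fun k => (hf k).aemeasurable, ← map_fst,
    Measure.map_map hm measurable_fst]
  rfl

theorem map_env_proxy (k : Fin K) : (law q).map (fun ω => (env k ω, proxy k ω)) =
    (q k).P.map fun ω => ((q k).env ω, (q k).proxy ω) := by
  have hm := (q k).measurable_env.prodMk (q k).measurable_proxy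
  rw [← (measurePreserving_eval (fun k => (q k).P) k).map_eq, ← map_fst,
    Measure.map_map (measurable_pi_apply k) measurable_fst,
    Measure.map_map hm ((measurable_pi_apply k).comp measurable_fst)]
  rfl

theorem map_envs : (law q).map (fun ω k => env k ω) = Measure.pi M.prior :=
  (map_pi fun k => (q k).measurable_env).trans
    (congrArg Measure.pi (funext fun k => (q k).map_env))

theorem map_envs_X : (law q).map (fun ω => ((fun k => env k ω), X ω)) =
    (Measure.pi M.prior).prod M.input := by
  have h : IndepFun (fun (ω : Combined q) k => env k ω) X (law q) :=
    indepFun_fst_snd.comp (measurable_pi_lambda _ fun k => (q k).measurable_env.comp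
      (measurable_pi_apply k)) (measurable_fst.comp measurable_down)
  rw [h.map_prod_eq_prod_map_map measurable_envs.aemeasurable measurable_X.aemeasurable, map_envs,
    map_X]

/-- `W` is independent of layers, proxies and input jointly, so knowing the proxies does not alter
the law of `Y` given layers and input. -/
theorem isCondLaw_channel :
    IsCondLaw (law q) (M.toEnvironment.channel.comap (fun ω => ((fun k => env k ω), X ω))
      (measurable_envs.prodMk measurable_X))
      (fun ω => ((fun k => env k ω), (fun k => proxy k ω), X ω)) Y := by
  refine isCondLaw_of_indepFun (measurable_envs.prodMk (measurable_proxies.prodMk measurable_X))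
    measurable_W ?_ (h := fun v w => M.U (Fin.last K) v.1 v.2.2 + w) ?_ _ fun ω => ?_
  · exact indepFun_fst_X_W.comp (φ := fun r => ((fun k => (q k).env (r.1 k)),
      (fun k => (q k).proxy (r.1 k)), r.2))
      ((measurable_pi_lambda _ fun k => (q k).measurable_env.comp
        ((measurable_pi_apply k).comp measurable_fst)).prodMk
        ((measurable_pi_lambda _ fun k => (q k).measurable_proxy.comp
          ((measurable_pi_apply k).comp measurable_fst)).prodMk measurable_snd)) measurable_id
  · exact ((M.measurable_U (Fin.last K)).comp
      ((measurable_fst.comp measurable_fst).prodMk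
        (measurable_snd.comp (measurable_snd.comp measurable_fst)))).add measurable_snd
  · rw [map_W, Kernel.comap_apply]
    exact gaussianChannel_apply _ _ _ _

theorem map_envs_X_Y : (law q).map (fun ω => (((fun k => env k ω), X ω), Y ω)) =
    M.toEnvironment.jointLaw := by
  have h := (isCondLaw_channel (q := q)).comp
    (measurable_envs.prodMk (measurable_proxies.prodMk measurable_X)) measurable_Y
    (g := fun v => (v.1, v.2.2)) (by fun_prop)
  rw [IsCondLaw, map_compProd_comap (measurable_envs.prodMk measurable_X), map_envs_X] at h
  exact h.symm

end Combined

open Combined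

/-- `(X, Y)` is a function of the layers and of the pair `(X, W)`, which is independent of layers
and proxies. -/
theorem Combined.condIndep_proxies :
    (fun (ω : Combined q) k => proxy k ω) ⟂ᵢ[fun ω k => env k ω, measurable_envs; law q]
      (fun ω => (X ω, Y ω)) := by
  have : Nonempty (Combined q) := nonempty_of_isProbabilityMeasure (law q)
  have : ∀ k, Nonempty (q k).Z := fun k => ‹Nonempty (Combined q)›.map (proxy k)
  refine condIndepFun_of_indepFun_noise measurable_envs measurable_proxies
    measurable_snd ?_ (g := fun t n => (n.down.1, M.U (Fin.last K) t n.down.1 + n.down.2)) ?_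
  · exact indepFun_fst_snd.comp (φ := fun r => ((fun k => (q k).env (r k)),
      (fun k => (q k).proxy (r k))))
      ((measurable_pi_lambda _ fun k => (q k).measurable_env.comp (measurable_pi_apply k)).prodMk
        (measurable_pi_lambda _ fun k => (q k).measurable_proxy.comp
          (measurable_pi_apply k))) measurable_id
  · have hn : Measurable fun p : (∀ k, Θ k) ×
        ULift.{u} ((Fin (dim 0) → ℝ) × (Fin (dim (Fin.last K)) → ℝ)) => p.2.down :=
      measurable_down.comp measurable_snd
    exact (measurable_fst.comp hn).prodMk (((M.measurable_U (Fin.last K)).comp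
      (measurable_fst.prodMk (measurable_fst.comp hn))).add (measurable_snd.comp hn))

/-- The proxy of the whole environment made of independent proxies of the layers. -/
noncomputable def combinedProxy : M.toEnvironment.Proxy where
  Ω := Combined q
  P := law q
  Z := ∀ k, (q k).Z
  env := fun ω k => env k ω
  X := X
  Y := Y
  proxy := fun ω k => proxy k ω
  measurable_env := measurable_envs
  measurable_X := measurable_X
  measurable_Y := measurable_Y
  measurable_proxy := measurable_proxies
  map_eq := map_envs_X_Y
  condIndep := condIndep_proxies q

/-- Up to regrouping, both measures are products over the layers; data processing handles the
regrouping and `klDiv_pi` the products. -/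
theorem rate_combinedProxy_le : (combinedProxy q).rate ≤ ∑ k, (q k).rate := by
  have hm : ∀ k, Measurable fun ω => ((q k).env ω, (q k).proxy ω) := fun k =>
    (q k).measurable_env.prodMk (q k).measurable_proxy
  have hp : ∀ k, IsProbabilityMeasure ((q k).P.map fun ω => ((q k).env ω, (q k).proxy ω)) :=
    fun k => Measure.isProbabilityMeasure_map (hm k).aemeasurable
  have hE : ∀ k, IsProbabilityMeasure ((q k).P.map (q k).env) :=
    fun k => Measure.isProbabilityMeasure_map (q k).measurable_env.aemeasurable
  have hA : ∀ k, IsProbabilityMeasure ((q k).P.map (q k).proxy) :=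
    fun k => Measure.isProbabilityMeasure_map (q k).measurable_proxy.aemeasurable
  have hz : Measurable fun p : ∀ k, Θ k × (q k).Z => ((fun k => (p k).1), (fun k => (p k).2)) := by
    fun_prop
  have h1 : (law q).map (fun ω => ((fun k => env k ω), (fun k => proxy k ω))) =
      (Measure.pi fun k => (q k).P.map fun ω => ((q k).env ω, (q k).proxy ω)).map
        (fun p => ((fun k => (p k).1), (fun k => (p k).2))) := by
    have hm' : Measurable fun (ω : Combined q) k => ((q k).env (ω.1 k), (q k).proxy (ω.1 k)) :=
      measurable_pi_lambda _ fun k => (measurable_env k).prodMk (measurable_proxy k)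
    rw [← map_pi hm, Measure.map_map hz hm']
    rfl
  have h2 : (law q).map (fun ω k => env k ω) = Measure.pi fun k => (q k).P.map (q k).env :=
    map_pi fun k => (q k).measurable_env
  have h3 : (law q).map (fun ω k => proxy k ω) = Measure.pi fun k => (q k).P.map (q k).proxy :=
    map_pi fun k => (q k).measurable_proxy
  change klDiv ((law q).map fun ω => ((fun k => env k ω), (fun k => proxy k ω)))
    (((law q).map fun ω k => env k ω).prod ((law q).map fun ω k => proxy k ω)) ≤ _
  rw [h1, h2, h3, ← pi_prod_map_eq]
  refine (klDiv_map_le _ _ hz).trans_eq ?_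
  rw [klDiv_pi]
  rfl

/-- All the other variables are functions of layer `k` and of `others k`, which is independent of
layer `k` and its proxy. -/
theorem Combined.condIndep_proxy [∀ k, StandardBorelSpace (Θ k)] (k : Fin K) :
    (proxy (q := q) k) ⟂ᵢ[env k, measurable_env k; law q]
      (fun ω => ((fun j : {j // j ≠ k} => env j.1 ω), (fun j : {j // j ≠ k} => proxy j.1 ω),
        X ω, Y ω)) := by
  have : Nonempty (Combined q) := nonempty_of_isProbabilityMeasure (law q)
  have : ∀ k, Nonempty (q k).Z := fun k => ‹Nonempty (Combined q)›.map (proxy k)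
  have : ∀ k, Nonempty (Θ k) := fun k => ‹Nonempty (Combined q)›.map (env k)
  have h := condIndepFun_of_indepFun_noise (measurable_env k) (measurable_proxy k)
    (measurable_others k) (indepFun_env_proxy_others k)
    (g := fun (t : Θ k) n => ((fun j : {j // j ≠ k} => (q j).env (n.1 j)),
      (fun j : {j // j ≠ k} => (q j).proxy (n.1 j)), n.2.down.1,
      M.U (Fin.last K) (fun j => if h : j = k then cast (congrArg Θ h.symm) t else
        (q j).env (n.1 ⟨j, h⟩)) n.2.down.1 + n.2.down.2)) ?_
  · convert h using 2 with ω
    simp only [Prod.mk.injEq]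
    refine ⟨rfl, rfl, rfl, ?_⟩
    have h1 : (fun j => env j ω) = fun j => if h : j = k then cast (congrArg Θ h.symm) (env k ω)
        else (q j).env ((others k ω).1 ⟨j, h⟩) := by
      funext j
      by_cases h : j = k
      · subst h; simp
      · simp [h, others, env]
    rw [Y, h1]
    rfl
  · have hn : Measurable fun p : Θ k × ((∀ j : {j // j ≠ k}, (q j).Ω) ×
        ULift.{u} ((Fin (dim 0) → ℝ) × (Fin (dim (Fin.last K)) → ℝ))) => p.2.2.down :=
      measurable_down.comp (measurable_snd.comp measurable_snd)
    have hc : ∀ j : {j // j ≠ k}, Measurable fun p : Θ k × ((∀ j : {j // j ≠ k}, (q j).Ω) ×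
        ULift.{u} ((Fin (dim 0) → ℝ) × (Fin (dim (Fin.last K)) → ℝ))) => p.2.1 j := fun j =>
      (measurable_pi_apply j).comp (measurable_fst.comp measurable_snd)
    have hθ : ∀ j, Measurable fun p : Θ k × ((∀ j : {j // j ≠ k}, (q j).Ω) ×
        ULift.{u} ((Fin (dim 0) → ℝ) × (Fin (dim (Fin.last K)) → ℝ))) =>
        if h : j = k then cast (congrArg Θ h.symm) p.1 else (q j).env (p.2.1 ⟨j, h⟩) := fun j => by
      split_ifs with h
      · exact measurable_cast_index h.symm measurable_fst
      · exact (q j).measurable_env.comp (hc ⟨j, h⟩)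
    exact (measurable_pi_lambda _ fun j => (q j.1).measurable_env.comp (hc j)).prodMk
      ((measurable_pi_lambda _ fun j => (q j.1).measurable_proxy.comp (hc j)).prodMk
      ((measurable_fst.comp hn).prodMk (((M.measurable_U (Fin.last K)).comp
        ((measurable_pi_lambda _ hθ).prodMk (measurable_fst.comp hn))).add
        (measurable_snd.comp hn))))

/-- The multilayer proxy made of independent proxies of the layers. -/
noncomputable def combinedMultilayerProxy [∀ k, StandardBorelSpace (Θ k)] : M.MultilayerProxy where
  Ω := Combined q
  P := law q
  Z := fun k => (q k).Z
  env := env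
  X := X
  Y := Y
  proxy := proxy
  measurable_env := measurable_env
  measurable_X := measurable_X
  measurable_Y := measurable_Y
  measurable_proxy := measurable_proxy
  map_eq := map_envs_X_Y
  condIndep := condIndep_proxy q

variable [∀ k, StandardBorelSpace (Θ k)] [∀ k, Nonempty (Θ k)]

theorem klError_combinedProxy_le :
    (combinedProxy q).klError ≤ ∑ k, (combinedMultilayerProxy q).layerContribution k := by
  have : Nonempty (Combined q) := nonempty_of_isProbabilityMeasure (law q)
  have : ∀ k, Nonempty (q k).Z := fun k => ‹Nonempty (Combined q)›.map (proxy k)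
  exact lintegral_klDiv_le_sum_condMutualInfo (P := law q) measurable_env measurable_proxy measurable_X
    measurable_Y M.toEnvironment.channel _ isCondLaw_channel (condIndep_proxy q)

omit [∀ k, StandardBorelSpace (Θ k)] in
/-- The true input of layer `k` is independent of layer `k` and its proxy. -/
theorem Combined.indepFun_env_proxy_U (k : Fin K) :
    IndepFun (fun ω : Combined q => (env k ω, proxy k ω))
      (fun ω => M.U k.castSucc (fun i => env i ω) (X ω)) (law q) := by
  -- The arbitrary value at index `k` is harmless: the input of layer `k` depends only on the
  -- earlier layers (`U_congr`).
  let θ (n : (∀ j : {j // j ≠ k}, (q j).Ω) ×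
      ULift.{u} ((Fin (dim 0) → ℝ) × (Fin (dim (Fin.last K)) → ℝ))) (j : Fin K) : Θ j :=
    if h : j = k then Classical.arbitrary _ else (q j).env (n.1 ⟨j, h⟩)
  have hθ : Measurable θ := measurable_pi_lambda _ fun j => by
    by_cases h : j = k
    · simp only [θ, dif_pos h]
      exact measurable_const
    · simp only [θ, dif_neg h]
      exact (q j).measurable_env.comp ((measurable_pi_apply _).comp measurable_fst)
  have h1 : (fun ω : Combined q => M.U k.castSucc (fun i => env i ω) (X ω)) =
      (fun n => M.U k.castSucc (θ n) n.2.down.1) ∘ others k := by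
    funext ω
    refine M.U_congr _ _ fun j hj => ?_
    have h1 : j ≠ k := (Fin.castSucc_lt_castSucc_iff.1 hj).ne
    simp [θ, h1, others, env]
  rw [h1]
  exact (indepFun_env_proxy_others (q := q) k).comp measurable_id
    ((M.measurable_U _).comp (hθ.prodMk
      (measurable_fst.comp (measurable_down.comp measurable_snd))))

/-- In both models the joint law is that of `(env, proxy)` times `layerInput`, and `Δ` sees only
this law. -/
theorem layerDistortion_combinedMultilayerProxy (k : Fin K)
    (Δ : DistortionFunction (Θ k) (Fin (dim k.castSucc) → ℝ)) :
    (combinedMultilayerProxy q).layerDistortion k Δ = (q k).distortion Δ := by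
  have hU : Measurable fun ω : Combined q => M.U k.castSucc (fun i => env i ω) (X ω) :=
    (M.measurable_U _).comp (measurable_envs.prodMk measurable_X)
  have hEA := (measurable_env (q := q) k).prodMk (measurable_proxy k)
  have h1 : (law q).map (fun ω => M.U k.castSucc (fun i => env i ω) (X ω)) = M.layerInput k := by
    rw [layerInput, ← map_envs_X (q := q), Measure.map_map (M.measurable_U _)
      (measurable_envs.prodMk measurable_X)]
    rfl
  have h2 := (indepFun_env_proxy_U q k).map_prod_eq_prod_map_map hEA.aemeasurable hU.aemeasurable
  rw [h1, map_env_proxy] at h2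
  have h3 := congrArg (Measure.map fun p => (p.1.1, p.1.2, p.2))
    (h2.trans (q k).map_env_proxy_X.symm)
  rw [Measure.map_map (by fun_prop) (hEA.prodMk hU), Measure.map_map (by fun_prop)
    (((q k).measurable_env.prodMk (q k).measurable_proxy).prodMk (q k).measurable_X)] at h3
  exact congrArg (Δ (q k).Z) h3

end MultilayerEnvironment

/-! ### Near-optimal proxies and passage to the infimum. -/

theorem mainTheorem5 {K : ℕ} (hK : 0 < K) {dim : Fin (K + 1) → ℕ} {Θ : Fin K → Type u}
    [∀ k, MeasurableSpace (Θ k)] [∀ k, StandardBorelSpace (Θ k)] [∀ k, Nonempty (Θ k)]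
    (M : MultilayerEnvironment dim Θ) (ε : ℝ≥0)
    (Δ : ∀ k : Fin K, DistortionFunction (Θ k) (Fin (dim k.castSucc) → ℝ))
    (hbound : ∀ (p : M.MultilayerProxy) (k : Fin K),
      p.layerContribution k ≤ p.layerDistortion k (Δ k))
    (hsmall : ∀ (k : Fin K) (δ : ℝ≥0), 0 < δ →
      ∃ p : (M.layerEnvironment k).Proxy, p.distortion (Δ k) ≤ δ) :
    M.toEnvironment.rateDistortion ε ≤
      ∑ k : Fin K, (M.layerEnvironment k).rateDistortionWith
        (fun p => p.distortion (Δ k)) (ε / (K : ℝ≥0)) := by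
  have key : ∀ q : ∀ k, (M.layerEnvironment k).Proxy,
      (∀ k, (q k).distortion (Δ k) ≤ (ε / (K : ℝ≥0) : ℝ≥0)) →
      M.toEnvironment.rateDistortion ε ≤ ∑ k, (q k).rate := fun q hq => by
    refine (iInf₂_le (MultilayerEnvironment.combinedProxy q) ?_).trans
      (MultilayerEnvironment.rate_combinedProxy_le q)
    calc (MultilayerEnvironment.combinedProxy q).klError
        ≤ ∑ k, (MultilayerEnvironment.combinedMultilayerProxy q).layerContribution k :=
          MultilayerEnvironment.klError_combinedProxy_le q
      _ ≤ ∑ _k : Fin K, ((ε / (K : ℝ≥0) : ℝ≥0) : ℝ≥0∞) := Finset.sum_le_sum fun k _ =>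
          (hbound _ k).trans
            ((MultilayerEnvironment.layerDistortion_combinedMultilayerProxy q k (Δ k)).trans_le
              (hq k))
      _ = ε := by
          have hK' : (K : ℝ≥0) ≠ 0 := by exact_mod_cast hK.ne'
          rw [Finset.sum_const, Finset.card_univ, Fintype.card_fin, nsmul_eq_mul,
            ← ENNReal.coe_natCast, ← ENNReal.coe_mul, mul_div_cancel₀ _ hK']
  by_cases htop : ∃ k, (M.layerEnvironment k).rateDistortionWith
      (fun p => p.distortion (Δ k)) (ε / (K : ℝ≥0)) = ⊤
  · obtain ⟨k, hk⟩ := htop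
    exact le_top.trans_eq (ENNReal.sum_eq_top.2 ⟨k, Finset.mem_univ k, hk⟩).symm
  push Not at htop
  -- A slack of `η / K` per layer adds up to `η`; finiteness of each infimum makes the slack strict,
  -- so a suitable proxy exists.
  refine ENNReal.le_of_forall_pos_le_add fun η hη _ => ?_
  have hη' : (0 : ℝ≥0∞) < (η / (K : ℝ≥0) : ℝ≥0) := by
    rw [ENNReal.coe_pos]; exact div_pos hη (by exact_mod_cast hK)
  have hex : ∀ k, ∃ p : (M.layerEnvironment k).Proxy,
      p.distortion (Δ k) ≤ (ε / (K : ℝ≥0) : ℝ≥0) ∧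
      p.rate ≤ (M.layerEnvironment k).rateDistortionWith
        (fun p => p.distortion (Δ k)) (ε / (K : ℝ≥0)) + (η / (K : ℝ≥0) : ℝ≥0) := fun k => by
    have hlt := ENNReal.lt_add_right (htop k) hη'.ne'
    conv_lhs at hlt => rw [Environment.rateDistortionWith]
    simp only [iInf_lt_iff] at hlt
    obtain ⟨p, hp, hr⟩ := hlt
    exact ⟨p, hp, hr.le⟩
  choose q hq hr using hex
  refine (key q hq).trans ((Finset.sum_le_sum fun k _ => hr k).trans_eq ?_)
  have hK' : (K : ℝ≥0) ≠ 0 := by exact_mod_cast hK.ne'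
  rw [Finset.sum_add_distrib, Finset.sum_const, Finset.card_univ, Fintype.card_fin, nsmul_eq_mul,
    ← ENNReal.coe_natCast, ← ENNReal.coe_mul, mul_div_cancel₀ _ hK']
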